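/- Let $n,m\ge 1$ be integers, let $1<q<2$ and $qp=2$, and let $A,\varepsilon,\varepsilon'>0$. Then there is a constant $C>0$, depending only on $n,m,q,A,\varepsilon,\varepsilon'$, such that the following holds. Let $\psi\in L^1(\mathbb{R}^n)\cap L^2(\mathbb{R}^n)$ be a complex-valued wavelet, i.e. $\int_{\mathbb{R}^n}\psi=0$, such that $$|\psi(x)|\le A(1+|x|)^{-n-\varepsilon}\quad (x\in\mathbb{R}^n),\qquad \int_{\mathbb{R}^n}|\psi(x+h)-\psi(x)|\,dx\le A|h|^{\varepsilon'}\quad (h\in\mathbb{R}^n\setminus\{0\}).$$ For $\lambda>0$ put $\psi_\lambda(x)=\lambda^{-n/2}\psi(\lambda^{-1}x)$ and for $j\in\mathbb{Z}$ put $\psi_j(x)=2^{-nj}\psi(2^{-j}x)$. For $f\in L^q(\mathbb{R}^n)$ (complex-valued) define the $m$-layer scattering transforms $$S^m_{\mathrm{cont},q}f(\lambda_1,\dots,\lambda_m)=\big\|\,||f*\psi_{\lambda_1}|*\psi_{\lambda_2}|*\cdots|*\psi_{\lambda_m}\big\|_q^q,\qquad (\lambda_1,\dots,\lambda_m)\in(0,\infty)^m,$$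 $$S^m_{\mathrm{dyad},q}f(j_1,\dots,j_m)=\big\|\,||f*\psi_{j_1}|*\psi_{j_2}|*\cdots|*\psi_{j_m}\big\|_q^q,\qquad (j_1,\dots,j_m)\in\mathbb{Z}^m.$$ Then, for every $f\in L^q(\mathbb{R}^n)$, all these $L^q$ norms are finite, $S^m_{\mathrm{cont},q}f$ is measurable, and $$\left(\int_0^\infty\!\cdots\!\int_0^\infty |S^m_{\mathrm{cont},q}f(\lambda_1,\dots,\lambda_m)|^p\,\frac{d\lambda_1}{\lambda_1^{n+1}}\cdots\frac{d\lambda_m}{\lambda_m^{n+1}}\right)^{1/p}\le C\|f\|_q^q,$$ $$\left(\sum_{(j_1,\dots,j_m)\in\mathbb{Z}^m}|S^m_{\mathrm{dyad},q}f(j_1,\dots,j_m)|^p\right)^{1/p}\le C\|f\|_q^q ;$$ in particular the integral and the sum are finite. -/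

import Mathlib

open MeasureTheory
open scoped ENNReal Convolution

namespace Scattering

/-- A wavelet on `ℝⁿ`: a complex function in `L¹ ∩ L²` with zero average. -/
structure IsWavelet {n : ℕ} (ψ : EuclideanSpace ℝ (Fin n) → ℂ) : Prop where
  memLp_one : MemLp ψ 1 volume
  memLp_two : MemLp ψ 2 volume
  integral_eq_zero : ∫ x, ψ x = 0

/-- The decay condition `|ψ(x)| ≤ A (1 + |x|)^(-n-ε)`. -/
def DecayCondition {n : ℕ} (A ε : ℝ) (ψ : EuclideanSpace ℝ (Fin n) → ℂ) : Prop :=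
  ∀ x, ‖ψ x‖ ≤ A * (1 + ‖x‖) ^ (-(n : ℝ) - ε)

/-- The `L¹`-Hölder condition `∫ |ψ(x+h) - ψ(x)| dx ≤ A |h|^ε'` for `h ≠ 0`. -/
def HolderCondition {n : ℕ} (A ε' : ℝ) (ψ : EuclideanSpace ℝ (Fin n) → ℂ) : Prop :=
  ∀ h, h ≠ 0 → ∫ x, ‖ψ (x + h) - ψ x‖ ≤ A * ‖h‖ ^ ε'

/-- The `L²`-normalized dilation `ψ_t(x) = t^(-n/2) ψ(t⁻¹ x)` with continuous scale `t > 0`. -/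
noncomputable def dilate {n : ℕ} (ψ : EuclideanSpace ℝ (Fin n) → ℂ) (t : ℝ) :
    EuclideanSpace ℝ (Fin n) → ℂ :=
  fun x => (t ^ (-(n : ℝ) / 2)) • ψ (t⁻¹ • x)

/-- The `L¹`-normalized dyadic dilation `ψ_j(x) = 2^(-nj) ψ(2^(-j) x)`, `j ∈ ℤ`. -/
noncomputable def dyadicDilate {n : ℕ} (ψ : EuclideanSpace ℝ (Fin n) → ℂ) (j : ℤ) :
    EuclideanSpace ℝ (Fin n) → ℂ :=
  fun x => ((2 : ℝ) ^ (-((n : ℤ) * j))) • ψ (((2 : ℝ) ^ (-j)) • x)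

/-- The cascade `||f ∗ g₁| ∗ g₂| ∗ ⋯ | ∗ g_m` of convolutions and moduli
(no modulus before the first convolution, none after the last one). -/
noncomputable def cascade {n : ℕ} : (m : ℕ) → (Fin m → EuclideanSpace ℝ (Fin n) → ℂ) →
    (EuclideanSpace ℝ (Fin n) → ℂ) → EuclideanSpace ℝ (Fin n) → ℂ
  | 0, _, f => f
  | 1, g, f => f ⋆[ContinuousLinearMap.mul ℝ ℂ, volume] g 0
  | m + 2, g, f =>
      (fun x => ((‖cascade (m + 1) (Fin.init g) f x‖ : ℝ) : ℂ))
        ⋆[ContinuousLinearMap.mul ℝ ℂ, volume] g (Fin.last (m + 1))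

/-- `||f ∗ ψ_{t₁}| ∗ ψ_{t₂}| ∗ ⋯ | ∗ ψ_{t_m}` for continuous scales. -/
noncomputable def contCascade {n m : ℕ} (ψ f : EuclideanSpace ℝ (Fin n) → ℂ) (t : Fin m → ℝ) :
    EuclideanSpace ℝ (Fin n) → ℂ :=
  cascade m (fun i => dilate ψ (t i)) f

/-- `||f ∗ ψ_{j₁}| ∗ ψ_{j₂}| ∗ ⋯ | ∗ ψ_{j_m}` for dyadic scales. -/
noncomputable def dyadCascade {n m : ℕ} (ψ f : EuclideanSpace ℝ (Fin n) → ℂ) (j : Fin m → ℤ) :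
    EuclideanSpace ℝ (Fin n) → ℂ :=
  cascade m (fun i => dyadicDilate ψ (j i)) f

/-- The `m`-layer continuous scattering transform
`(t₁, …, t_m) ↦ ‖||f ∗ ψ_{t₁}| ∗ ψ_{t₂}| ∗ ⋯ | ∗ ψ_{t_m}‖_q^q`. -/
noncomputable def contScattering {n m : ℕ} (q : ℝ) (ψ f : EuclideanSpace ℝ (Fin n) → ℂ)
    (t : Fin m → ℝ) : ℝ :=
  lpNorm (contCascade ψ f t) (ENNReal.ofReal q) volume ^ q

/-- The `m`-layer dyadic scattering transform
`(j₁, …, j_m) ↦ ‖||f ∗ ψ_{j₁}| ∗ ψ_{j₂}| ∗ ⋯ | ∗ ψ_{j_m}‖_q^q`. -/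
noncomputable def dyadScattering {n m : ℕ} (q : ℝ) (ψ f : EuclideanSpace ℝ (Fin n) → ℂ)
    (j : Fin m → ℤ) : ℝ :=
  lpNorm (dyadCascade ψ f j) (ENNReal.ofReal q) volume ^ q

/-- The measure `dt / t^(n+1)` on `ℝ₊ = (0, ∞)`, viewed as a measure on `ℝ`. -/
noncomputable def scaleMeasure (n : ℕ) : Measure ℝ :=
  (volume.restrict (Set.Ioi (0 : ℝ))).withDensity (fun t => ENNReal.ofReal (1 / t ^ (n + 1)))

instance scaleMeasure_sigmaFinite (n : ℕ) : SigmaFinite (scaleMeasure n) := by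
  unfold scaleMeasure
  exact SigmaFinite.withDensity_of_ne_top (Filter.Eventually.of_forall fun _ => ENNReal.ofReal_ne_top)

/-- The product measure `dt₁ / t₁^(n+1) ⋯ dt_m / t_m^(n+1)` on `ℝ₊^m`. -/
noncomputable def scaleMeasurePi (n m : ℕ) : Measure (Fin m → ℝ) :=
  Measure.pi (fun _ : Fin m => scaleMeasure n)

end Scattering

/-! Since `q * p = 2`, the `p`-th power of a `q`-th power of an L^q norm is the squared norm. Both
inequalities therefore say that the cascades are square summable over their scales, with values in
L^q. The modulus preserves the L^q norm, so it is enough to prove the one-layer bound ∑_j ‖f ∗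
ψ_j‖_q² ≤ C ‖f‖_q² and to iterate it (`lintegral_opCascade_le`).

The one-layer bound rests on the 2-uniform convexity of L^q for 1 < q < 2 (`twoUniformlyConvex_Lp`).
Let R_k average translations over the ball of radius 2^k. The R_k are commuting contractions, and
convexity bounds a multiple of ‖x - R_k² x‖² by the loss ‖x‖² - ‖R_k² x‖²
(`norm_sub_avg_avg_sq_le`). Along products of the R_k² the losses telescope, so the increments are
square summable, much like martingale differences (`sum_sqDiff_le`). Convolution with ψ at scale 2^j
almost annihilates R_k for k ≥ j (mean zero and a moment of ψ) and 1 - R_k for k ≤ j (Hölder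
condition), with a geometric gain in |j - k|. Schur's test then gives square summability
(`sum_norm_sq_le_of_adapted`).

The constant is the same for every isometric representation of ℝⁿ on the given space. Rescaling the
representation gives all scales s 2^j with j ∈ ℤ, uniformly in s, and integrating over s ∈ [1, 2)
gives the measure dt/t. The L² normalization contributes t^(n/2) per layer, whose square turns
dt/t^(n+1) into dt/t. -/

namespace Scattering

/-! ### Two-uniform convexity of `L^q` for `1 < q < 2` -/

/-- A normed group is 2-uniformly convex with constant `c`. -/
def TwoUniformlyConvex (X : Type*) [NormedAddCommGroup X] (c : ℝ) : Prop :=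
  ∀ x y : X, ‖x + y‖ ^ 2 / 4 + c * ‖x - y‖ ^ 2 ≤ (‖x‖ ^ 2 + ‖y‖ ^ 2) / 2

theorem convexOn_midpoint_le {s : Set ℝ} {f : ℝ → ℝ} (hf : ConvexOn ℝ s f) {x y : ℝ} (hx : x ∈ s)
    (hy : y ∈ s) : f (1 / 2 * x + 1 / 2 * y) ≤ 1 / 2 * f x + 1 / 2 * f y :=
  hf.2 hx hy (by norm_num) (by norm_num) (by norm_num)

/-- On (0, 1) the second derivative of s^q is at least q(q-1), so subtracting q(q-1)/2 · s² leaves a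
convex function. Its midpoint inequality between 1 and x gives the bound with a spare factor q. -/
theorem rpow_strong_midpoint {q x : ℝ} (hq1 : 1 < q) (hq2 : q < 2) (hx0 : 0 ≤ x) (hx1 : x ≤ 1) :
    (q - 1) * (1 - x) ^ 2 ≤ 4 * (1 + x ^ q - 2 * ((1 + x) / 2) ^ q) := by
  have hconv : ConvexOn ℝ (Set.Icc (0 : ℝ) 1) (fun s => s ^ q - q * (q - 1) / 2 * s ^ 2) := by
    refine convexOn_of_hasDerivWithinAt2_nonneg (convex_Icc 0 1)
      (f' := fun s => q * s ^ (q - 1) - q * (q - 1) / 2 * (2 * s))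
      (f'' := fun s => q * ((q - 1) * s ^ (q - 2)) - q * (q - 1) / 2 * 2) ?_ ?_ ?_ ?_
    · exact ((Real.continuous_rpow_const (by linarith)).sub (by fun_prop)).continuousOn
    · intro s hs
      rw [interior_Icc] at hs
      have h1 := Real.hasDerivAt_rpow_const (x := s) (p := q) (Or.inl hs.1.ne')
      have h2 := ((hasDerivAt_pow 2 s).const_mul (q * (q - 1) / 2))
      refine ((h1.sub h2).congr_deriv ?_).hasDerivWithinAt
      norm_num
    · intro s hs
      rw [interior_Icc] at hs
      have h1 := (Real.hasDerivAt_rpow_const (x := s) (p := q - 1) (Or.inl hs.1.ne')).const_mul q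
      have h2 := (((hasDerivAt_id s).const_mul 2).const_mul (q * (q - 1) / 2))
      refine ((h1.sub h2).congr_deriv ?_).hasDerivWithinAt
      ring_nf
    · intro s hs
      rw [interior_Icc] at hs
      have : 1 ≤ s ^ (q - 2) :=
        Real.one_le_rpow_of_pos_of_le_one_of_nonpos hs.1 hs.2.le (by linarith)
      nlinarith [mul_pos (by linarith : (0 : ℝ) < q) (by linarith : (0 : ℝ) < q - 1)]
  have h := convexOn_midpoint_le hconv (x := 1) (y := x) ⟨zero_le_one, le_rfl⟩ ⟨hx0, hx1⟩
  simp only [Real.one_rpow] at h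
  rw [show (1 / 2 * 1 + 1 / 2 * x : ℝ) = (1 + x) / 2 by ring] at h
  nlinarith [mul_nonneg (mul_nonneg (by linarith : (0 : ℝ) ≤ q - 1) (by linarith : (0 : ℝ) ≤ q - 1))
    (sq_nonneg (1 - x))]

/-- Bernoulli's inequality with exponent q/2 ≤ 1 at (w/s)² settles the case s = 1; scaling costs
only s² ≤ s^q, valid on [0, 1]. -/
theorem rpow_sub_rpow_ge {q w s : ℝ} (hq1 : 1 < q) (hq2 : q < 2) (hw : 0 ≤ w) (hws : w ≤ s)
    (hs : s ≤ 1) : q / 2 * (s ^ 2 - w ^ 2) ≤ s ^ q - w ^ q := by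
  rcases (hw.trans hws).eq_or_lt with h0 | h0
  · obtain rfl : w = s := le_antisymm hws (h0 ▸ hw)
    simp
  have hd : 0 ≤ w / s := by positivity
  have hd1 : w / s ≤ 1 := (div_le_one h0).2 hws
  have h := rpow_one_add_le_one_add_mul_self (s := (w / s) ^ 2 - 1) (by nlinarith [sq_nonneg (w / s)])
    (p := q / 2) (by linarith) (by linarith)
  rw [add_sub_cancel, ← Real.rpow_natCast, ← Real.rpow_mul hd] at h
  rw [show ((2 : ℕ) : ℝ) * (q / 2) = q by push_cast; ring, Real.rpow_natCast,
    Real.div_rpow hw h0.le] at h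
  have hsq : 0 < s ^ q := Real.rpow_pos_of_pos h0 q
  rw [div_le_iff₀ hsq] at h
  have h2 : s ^ 2 ≤ s ^ q := by
    rw [← Real.rpow_natCast]
    exact Real.rpow_le_rpow_of_exponent_ge h0 hs (by push_cast; linarith)
  have h3 : s ^ 2 * (1 - (w / s) ^ 2) ≤ s ^ q * (1 - (w / s) ^ 2) :=
    mul_le_mul_of_nonneg_right h2 (by nlinarith)
  have h4 : s ^ 2 * (1 - (w / s) ^ 2) = s ^ 2 - w ^ 2 := by field_simp
  nlinarith

/-- After scaling to ‖a‖ = 1, with x = ‖b‖ and w = ‖a + b‖/2, the parallelogram law splits ‖a - b‖²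
into (1-x)² and 4(((1+x)/2)² - w²). The first part, from the lengths, is covered by strong convexity
of s^q, the second, from the angle, by `rpow_sub_rpow_ge`. The last factor of the bound restores
homogeneity of degree 2. -/
theorem norm_sub_sq_le_of_norm_le {q : ℝ} (hq1 : 1 < q) (hq2 : q < 2) {a b : ℂ} (hab : ‖b‖ ≤ ‖a‖) :
    (q - 1) * ‖a - b‖ ^ 2 ≤ 4 * (‖a‖ ^ q + ‖b‖ ^ q - 2 * (‖a + b‖ / 2) ^ q) *
      (‖a‖ ^ q + ‖b‖ ^ q) ^ (2 / q - 1) := by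
  rcases (norm_nonneg a).eq_or_lt with h0 | h0
  · have ha : a = 0 := norm_eq_zero.1 h0.symm
    have hb : b = 0 := norm_eq_zero.1 (le_antisymm (h0 ▸ hab) (norm_nonneg b))
    subst ha hb
    simp [Real.zero_rpow (by linarith : q ≠ 0)]
  have hq0 : 0 < q := by linarith
  set M := ‖a‖ with hM
  set x := ‖b‖ / M with hx
  set w := ‖a + b‖ / 2 / M with hw
  have hb : ‖b‖ = M * x := by rw [hx]; field_simp
  have hw' : ‖a + b‖ / 2 = M * w := by rw [hw]; field_simp
  have hx0 : 0 ≤ x := by positivity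
  have hx1 : x ≤ 1 := (div_le_one h0).2 hab
  have hw0 : 0 ≤ w := by positivity
  have hws : w ≤ (1 + x) / 2 := by
    have := norm_add_le a b
    have h2 : M * w ≤ M * ((1 + x) / 2) := by nlinarith
    exact le_of_mul_le_mul_left h2 h0
  have h1 := rpow_strong_midpoint hq1 hq2 hx0 hx1
  have h2 := rpow_sub_rpow_ge hq1 hq2 hw0 hws (by linarith)
  have hsq : 0 ≤ ((1 + x) / 2) ^ 2 - w ^ 2 := by nlinarith
  have hd : (q - 1) * ((1 - x) ^ 2 + 4 * (((1 + x) / 2) ^ 2 - w ^ 2)) ≤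
      4 * (1 + x ^ q - 2 * w ^ q) := by nlinarith
  have hpar : ‖a - b‖ ^ 2 = M ^ 2 * ((1 - x) ^ 2 + 4 * (((1 + x) / 2) ^ 2 - w ^ 2)) := by
    have hp := parallelogram_law_with_norm ℝ a b
    have hab2 : ‖a + b‖ = 2 * (M * w) := by linarith
    rw [← hM, hab2, hb] at hp
    nlinarith
  have hd0 : 0 ≤ 4 * (1 + x ^ q - 2 * w ^ q) :=
    le_trans (mul_nonneg (by linarith) (by positivity)) hd
  have hN : M ^ (2 - q) ≤ (M ^ q + ‖b‖ ^ q) ^ (2 / q - 1) := by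
    have h3 : M ^ (2 - q) = (M ^ q) ^ (2 / q - 1) := by
      rw [← Real.rpow_mul h0.le]; congr 1; field_simp
    rw [h3]
    refine Real.rpow_le_rpow (by positivity) (by linarith [Real.rpow_nonneg (norm_nonneg b) q]) ?_
    rw [sub_nonneg, le_div_iff₀ hq0]; linarith
  have hM2 : M ^ q * M ^ (2 - q) = M ^ 2 := by
    rw [← Real.rpow_add h0, ← Real.rpow_natCast]; congr 1; push_cast; ring
  have hD : ‖a‖ ^ q + ‖b‖ ^ q - 2 * (‖a + b‖ / 2) ^ q = M ^ q * (1 + x ^ q - 2 * w ^ q) := by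
    rw [hb, hw', Real.mul_rpow h0.le hx0, Real.mul_rpow h0.le hw0]; ring
  rw [← hM] at hD
  rw [hD, hpar]
  calc (q - 1) * (M ^ 2 * ((1 - x) ^ 2 + 4 * (((1 + x) / 2) ^ 2 - w ^ 2)))
      ≤ M ^ 2 * (4 * (1 + x ^ q - 2 * w ^ q)) := by nlinarith [sq_nonneg M]
    _ = (4 * (1 + x ^ q - 2 * w ^ q)) * M ^ q * M ^ (2 - q) := by rw [← hM2]; ring
    _ ≤ (4 * (1 + x ^ q - 2 * w ^ q)) * M ^ q * (M ^ q + ‖b‖ ^ q) ^ (2 / q - 1) := by gcongr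
    _ = _ := by ring

theorem norm_sub_sq_le {q : ℝ} (hq1 : 1 < q) (hq2 : q < 2) (a b : ℂ) :
    (q - 1) * ‖a - b‖ ^ 2 ≤ 4 * (‖a‖ ^ q + ‖b‖ ^ q - 2 * (‖a + b‖ / 2) ^ q) *
      (‖a‖ ^ q + ‖b‖ ^ q) ^ (2 / q - 1) := by
  rcases le_total ‖b‖ ‖a‖ with h | h
  · exact norm_sub_sq_le_of_norm_le hq1 hq2 h
  · have := norm_sub_sq_le_of_norm_le hq1 hq2 h
    rwa [norm_sub_rev, add_comm b a, add_comm (‖b‖ ^ q)] at this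

theorem rpow_midpoint_le {q : ℝ} (hq1 : 1 < q) (a b : ℂ) :
    2 * (‖a + b‖ / 2) ^ q ≤ ‖a‖ ^ q + ‖b‖ ^ q := by
  have h := convexOn_midpoint_le (convexOn_rpow hq1.le) (norm_nonneg a) (norm_nonneg b)
  have h2 : (‖a + b‖ / 2) ^ q ≤ (1 / 2 * ‖a‖ + 1 / 2 * ‖b‖) ^ q :=
    Real.rpow_le_rpow (by positivity) (by linarith [norm_add_le a b]) (by linarith)
  linarith

theorem integral_rpow_mul_rpow_le {α : Type*} [MeasurableSpace α] {μ : Measure α} {f g : α → ℝ}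
    (hf : Integrable f μ) (hg : Integrable g μ) (hf0 : ∀ x, 0 ≤ f x) (hg0 : ∀ x, 0 ≤ g x)
    {s t : ℝ} (hs : 0 ≤ s) (ht : 0 ≤ t) (hst : s + t = 1) :
    ∫ x, f x ^ s * g x ^ t ∂μ ≤ (∫ x, f x ∂μ) ^ s * (∫ x, g x ∂μ) ^ t := by
  have key := ENNReal.lintegral_mul_norm_pow_le (μ := μ)
    (f := fun x => ENNReal.ofReal (f x)) (g := fun x => ENNReal.ofReal (g x))
    hf.aemeasurable.ennreal_ofReal hg.aemeasurable.ennreal_ofReal hs ht hst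
  rw [← ofReal_integral_eq_lintegral_ofReal hf (.of_forall hf0),
    ← ofReal_integral_eq_lintegral_ofReal hg (.of_forall hg0),
    ENNReal.ofReal_rpow_of_nonneg (integral_nonneg hf0) hs,
    ENNReal.ofReal_rpow_of_nonneg (integral_nonneg hg0) ht,
    ← ENNReal.ofReal_mul (Real.rpow_nonneg (integral_nonneg hf0) _)] at key
  rw [integral_eq_lintegral_of_nonneg_ae]
  · refine ENNReal.toReal_le_of_le_ofReal ?_ (le_trans (le_of_eq ?_) key)
    · exact mul_nonneg (Real.rpow_nonneg (integral_nonneg hf0) _)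
        (Real.rpow_nonneg (integral_nonneg hg0) _)
    · refine lintegral_congr fun x => ?_
      rw [ENNReal.ofReal_rpow_of_nonneg (hf0 x) hs, ENNReal.ofReal_rpow_of_nonneg (hg0 x) ht,
        ← ENNReal.ofReal_mul (Real.rpow_nonneg (hf0 x) _)]
  · exact .of_forall fun x => mul_nonneg (Real.rpow_nonneg (hf0 x) _) (Real.rpow_nonneg (hg0 x) _)
  · exact ((hf.aemeasurable.pow_const _).mul (hg.aemeasurable.pow_const _)).aestronglyMeasurable

theorem Lp_norm_rpow {α : Type*} [MeasurableSpace α] {μ : Measure α} {q : ℝ} (hq : 0 < q)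
    (f : Lp ℂ (ENNReal.ofReal q) μ) : ‖f‖ ^ q = ∫ x, ‖f x‖ ^ q ∂μ := by
  have h0 : ENNReal.ofReal q ≠ 0 := by simpa using hq
  have h := (Lp.memLp f).eLpNorm_eq_integral_rpow_norm h0 ENNReal.ofReal_ne_top
  rw [ENNReal.toReal_ofReal hq.le] at h
  have hI : 0 ≤ ∫ x, ‖f x‖ ^ q ∂μ := integral_nonneg fun x => by positivity
  rw [Lp.norm_def, h, ENNReal.toReal_ofReal (by positivity), ← Real.rpow_mul hI,
    inv_mul_cancel₀ hq.ne', Real.rpow_one]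

theorem integrable_norm_rpow_Lp {α : Type*} [MeasurableSpace α] {μ : Measure α} {q : ℝ}
    (hq : 0 < q) (f : Lp ℂ (ENNReal.ofReal q) μ) : Integrable (fun x => ‖f x‖ ^ q) μ := by
  have h := (Lp.memLp f).integrable_norm_rpow (by simpa using hq) ENNReal.ofReal_ne_top
  rwa [ENNReal.toReal_ofReal hq.le] at h

/-- The pointwise inequality bounds |f - g|^q by the convexity defect `d` to the power q/2 times `N`
to the power 1 - q/2, which is the shape Hölder's inequality integrates. -/
theorem twoUniformlyConvex_Lp {α : Type*} [MeasurableSpace α] {μ : Measure α} {q : ℝ}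
    [Fact (1 ≤ ENNReal.ofReal q)] (hq1 : 1 < q) (hq2 : q < 2) :
    TwoUniformlyConvex (Lp ℂ (ENNReal.ofReal q) μ) ((q - 1) / 16) := by
  intro f g
  have hq0 : 0 < q := by linarith
  set d : α → ℝ := fun x => ‖f x‖ ^ q + ‖g x‖ ^ q - 2 * (‖f x + g x‖ / 2) ^ q with hd
  set N : α → ℝ := fun x => ‖f x‖ ^ q + ‖g x‖ ^ q with hN
  have hf := integrable_norm_rpow_Lp hq0 f
  have hg := integrable_norm_rpow_Lp hq0 g
  have hu : Integrable (fun x => (‖f x + g x‖ / 2) ^ q) μ := by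
    refine ((integrable_norm_rpow_Lp hq0 (f + g)).div_const (2 ^ q)).congr ?_
    filter_upwards [Lp.coeFn_add f g] with x hx
    rw [hx, Real.div_rpow (norm_nonneg _) zero_le_two]; rfl
  have hUeq : ∫ x, (‖f x + g x‖ / 2) ^ q ∂μ = (‖f + g‖ / 2) ^ q := by
    rw [Real.div_rpow (norm_nonneg _) zero_le_two, Lp_norm_rpow hq0, ← integral_div]
    refine integral_congr_ae ?_
    filter_upwards [Lp.coeFn_add f g] with x hx
    rw [hx, Real.div_rpow (norm_nonneg _) zero_le_two]; rfl
  have hNi : Integrable N μ := hf.add hg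
  have hdi : Integrable d μ := hNi.sub (hu.const_mul 2)
  have hd0 : ∀ x, 0 ≤ d x := fun x => sub_nonneg.2 (rpow_midpoint_le hq1 _ _)
  have hN0 : ∀ x, 0 ≤ N x := fun x => by positivity
  have hNint : ∫ x, N x ∂μ = ‖f‖ ^ q + ‖g‖ ^ q := by
    rw [integral_add hf hg, Lp_norm_rpow hq0, Lp_norm_rpow hq0]
  have hdint : ∫ x, d x ∂μ = ‖f‖ ^ q + ‖g‖ ^ q - 2 * (‖f + g‖ / 2) ^ q := by
    rw [← hNint, ← hUeq, ← integral_const_mul, ← integral_sub hNi (hu.const_mul 2)]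
  have hexp : 0 ≤ 1 - q / 2 := by linarith
  have hholder := integral_rpow_mul_rpow_le hdi hNi hd0 hN0 (by linarith : 0 ≤ q / 2) hexp
    (by ring)
  set K : ℝ := 4 / (q - 1) with hK
  have hK0 : 0 < K := div_pos (by norm_num) (by linarith)
  have hpt : ∀ x, ‖f x - g x‖ ^ q ≤ K ^ (q / 2) * (d x ^ (q / 2) * N x ^ (1 - q / 2)) := by
    intro x
    have h := norm_sub_sq_le hq1 hq2 (f x) (g x)
    have h1 : ‖f x - g x‖ ^ 2 ≤ K * (d x * N x ^ (2 / q - 1)) := by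
      rw [hK, div_mul_eq_mul_div, le_div_iff₀ (by linarith)]
      calc _ = (q - 1) * ‖f x - g x‖ ^ 2 := by ring
        _ ≤ _ := h
        _ = _ := by rw [hd, hN]; ring
    have h2 := Real.rpow_le_rpow (by positivity) h1 (by linarith : 0 ≤ q / 2)
    rw [← Real.rpow_natCast, ← Real.rpow_mul (norm_nonneg _),
      Real.mul_rpow hK0.le (mul_nonneg (hd0 x) (Real.rpow_nonneg (hN0 x) _)),
      Real.mul_rpow (hd0 x) (Real.rpow_nonneg (hN0 x) _), ← Real.rpow_mul (hN0 x)] at h2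
    rw [show ((2 : ℕ) : ℝ) * (q / 2) = q by push_cast; ring,
      show (2 / q - 1) * (q / 2) = 1 - q / 2 by field_simp] at h2
    exact h2
  have hVint : ‖f - g‖ ^ q ≤ K ^ (q / 2) *
      ((∫ x, d x ∂μ) ^ (q / 2) * (∫ x, N x ∂μ) ^ (1 - q / 2)) := by
    have heq : ‖f - g‖ ^ q = ∫ x, ‖f x - g x‖ ^ q ∂μ := by
      rw [Lp_norm_rpow hq0]
      refine integral_congr_ae ?_
      filter_upwards [Lp.coeFn_sub f g] with x hx
      rw [hx]; rfl
    have hint : Integrable (fun x => d x ^ (q / 2) * N x ^ (1 - q / 2)) μ := by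
      refine (hdi.add hNi).mono' ((hdi.aemeasurable.pow_const _).mul
        (hNi.aemeasurable.pow_const _)).aestronglyMeasurable (.of_forall fun x => ?_)
      rw [Real.norm_of_nonneg
        (mul_nonneg (Real.rpow_nonneg (hd0 x) _) (Real.rpow_nonneg (hN0 x) _))]
      have := Real.geom_mean_le_arith_mean2_weighted (by linarith : 0 ≤ q / 2) hexp
        (hd0 x) (hN0 x) (by ring)
      simp only [Pi.add_apply]
      nlinarith [hd0 x, hN0 x]
    rw [heq]
    refine (integral_mono_of_nonneg (.of_forall fun x => by positivity)
      (hint.const_mul (K ^ (q / 2))) (.of_forall hpt)).trans ?_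
    rw [integral_const_mul]
    gcongr
  set D := ∫ x, d x ∂μ with hDdef
  set S := (‖f‖ ^ q + ‖g‖ ^ q) / 2 with hS
  set U := (‖f + g‖ / 2) ^ q with hU
  have hS0 : 0 ≤ S := by positivity
  have hU0 : 0 ≤ U := by positivity
  have hD0 : 0 ≤ D := integral_nonneg hd0
  have hDS : D = 2 * (S - U) := by rw [hdint]; ring
  have hUS : U ≤ S := by linarith
  have hNS : ∫ x, N x ∂μ = 2 * S := by rw [hNint]; ring
  rw [hNS] at hVint
  have hV2 : ‖f - g‖ ^ 2 ≤ K * (D * (2 * S) ^ (2 / q - 1)) := by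
    have h2 := Real.rpow_le_rpow (by positivity) hVint (by positivity : 0 ≤ 2 / q)
    rw [Real.mul_rpow (by positivity) (by positivity), Real.mul_rpow (by positivity) (by positivity),
      ← Real.rpow_mul hK0.le, ← Real.rpow_mul hD0, ← Real.rpow_mul (norm_nonneg _),
      ← Real.rpow_mul (by positivity : 0 ≤ 2 * S)] at h2
    rw [show q / 2 * (2 / q) = 1 by field_simp, show (1 - q / 2) * (2 / q) = 2 / q - 1 by field_simp,
      show q * (2 / q) = ((2 : ℕ) : ℝ) by field_simp; norm_num, Real.rpow_natCast, Real.rpow_one,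
      Real.rpow_one] at h2
    exact h2
  have h2q : 1 ≤ 2 / q := by rw [le_div_iff₀ hq0]; linarith
  have hpow : ∀ z : ℝ, 0 ≤ z → z * z ^ (2 / q - 1) = z ^ (2 / q) := by
    intro z hz
    rcases hz.eq_or_lt with rfl | hz
    · rw [zero_mul, Real.zero_rpow (by positivity)]
    · nth_rewrite 1 [← Real.rpow_one z]
      rw [← Real.rpow_add hz]; congr 1; ring
  have hUp : U ^ (2 / q) = ‖f + g‖ ^ 2 / 4 := by
    rw [hU, ← Real.rpow_mul (by positivity), show q * (2 / q) = ((2 : ℕ) : ℝ) by field_simp; norm_num,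
      Real.rpow_natCast]; ring
  have hSp : S ^ (2 / q) ≤ (‖f‖ ^ 2 + ‖g‖ ^ 2) / 2 := by
    have h := convexOn_midpoint_le (convexOn_rpow h2q) (Real.rpow_nonneg (norm_nonneg f) q)
      (Real.rpow_nonneg (norm_nonneg g) q)
    simp only [← Real.rpow_mul (norm_nonneg _)] at h
    rw [show q * (2 / q) = ((2 : ℕ) : ℝ) by field_simp; norm_num, Real.rpow_natCast,
      Real.rpow_natCast, show 1 / 2 * ‖f‖ ^ q + 1 / 2 * ‖g‖ ^ q = S by rw [hS]; ring] at h
    linarith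
  have hUS2 : U ^ (2 / q) ≤ U * S ^ (2 / q - 1) := by
    rw [← hpow U hU0]
    exact mul_le_mul_of_nonneg_left (Real.rpow_le_rpow hU0 hUS (by linarith)) hU0
  have h2le : (2 : ℝ) ^ (2 / q - 1) ≤ 2 := by
    have : 2 / q ≤ 2 := by rw [div_le_iff₀ hq0]; linarith
    calc (2 : ℝ) ^ (2 / q - 1) ≤ 2 ^ (1 : ℝ) :=
          Real.rpow_le_rpow_of_exponent_le one_le_two (by linarith)
      _ = 2 := Real.rpow_one 2
  -- With `D = 2 * (S - U)` and 2^(2/q-1) ≤ 2, this is U · S^(2/q-1) ≥ U^(2/q), that is, U ≤ S. The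
  -- factor 4 here times `K = 4 / (q - 1)` yields the constant (q-1)/16.
  have hfin : D * (2 * S) ^ (2 / q - 1) ≤ 4 * (S ^ (2 / q) - U ^ (2 / q)) := by
    rw [Real.mul_rpow zero_le_two hS0, hDS]
    have hSU : 0 ≤ (S - U) * S ^ (2 / q - 1) :=
      mul_nonneg (by linarith) (Real.rpow_nonneg hS0 _)
    nlinarith [hpow S hS0]
  have : (q - 1) / 16 * ‖f - g‖ ^ 2 ≤ S ^ (2 / q) - U ^ (2 / q) := by
    have h3 : K * (D * (2 * S) ^ (2 / q - 1)) ≤ K * (4 * (S ^ (2 / q) - U ^ (2 / q))) := by gcongr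
    have h4 : (q - 1) / 16 * (K * (4 * (S ^ (2 / q) - U ^ (2 / q)))) =
        S ^ (2 / q) - U ^ (2 / q) := by
      rw [hK]; have : q - 1 ≠ 0 := by linarith
      field_simp; norm_num
    rw [← h4]
    exact mul_le_mul_of_nonneg_left (hV2.trans h3) (by linarith)
  linarith

/-! ### An almost orthogonality principle for commuting contractions -/

theorem sum_range_pow_le {r : ℝ} (hr0 : 0 ≤ r) (hr1 : r < 1) (N : ℕ) :
    ∑ k ∈ Finset.range N, r ^ k ≤ 1 / (1 - r) := by
  rw [one_div, ← tsum_geometric_of_lt_one hr0 hr1]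
  exact (summable_geometric_of_lt_one hr0 hr1).sum_le_tsum _ fun _ _ => pow_nonneg hr0 _

/-- Subtraction is truncated, so the exponent is |j - k|; each side of `j` contributes a geometric
series. -/
theorem sum_range_pow_dist_le {r : ℝ} (hr0 : 0 ≤ r) (hr1 : r < 1) (j N : ℕ) :
    ∑ k ∈ Finset.range N, r ^ ((j - k) + (k - j)) ≤ 2 / (1 - r) := by
  have h1 : ∑ k ∈ Finset.range N, r ^ ((j - k) + (k - j)) ≤
      ∑ k ∈ Finset.range (j + N), r ^ ((j - k) + (k - j)) :=
    Finset.sum_le_sum_of_subset_of_nonneg (Finset.range_mono (by omega))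
      fun _ _ _ => pow_nonneg hr0 _
  refine h1.trans ?_
  rw [Finset.sum_range_add]
  have h2 : ∑ k ∈ Finset.range j, r ^ ((j - k) + (k - j)) ≤ 1 / (1 - r) := by
    rw [← Finset.sum_range_reflect]
    refine le_trans (Finset.sum_le_sum fun k hk => ?_) (sum_range_pow_le hr0 hr1 j)
    rw [Finset.mem_range] at hk
    exact pow_le_pow_of_le_one hr0 hr1.le (by omega)
  have h3 : ∑ k ∈ Finset.range N, r ^ ((j - (j + k)) + (j + k - j)) ≤ 1 / (1 - r) := by
    refine le_trans (le_of_eq (Finset.sum_congr rfl fun k _ => ?_)) (sum_range_pow_le hr0 hr1 N)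
    congr 1; omega
  calc _ ≤ 1 / (1 - r) + 1 / (1 - r) := add_le_add h2 h3
    _ = 2 / (1 - r) := by ring

/-- Schur's test: Cauchy–Schwarz with the kernel as weight, then row and column sums at most
2/(1-r). -/
theorem schur_range {r : ℝ} (hr0 : 0 ≤ r) (hr1 : r < 1) (J N : ℕ) (b : ℕ → ℝ) :
    ∑ j ∈ Finset.range J, (∑ k ∈ Finset.range N, r ^ ((j - k) + (k - j)) * b k) ^ 2 ≤
      (2 / (1 - r)) ^ 2 * ∑ k ∈ Finset.range N, b k ^ 2 := by
  have hW : 0 ≤ 2 / (1 - r) := div_nonneg zero_le_two (by linarith)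
  calc ∑ j ∈ Finset.range J, (∑ k ∈ Finset.range N, r ^ ((j - k) + (k - j)) * b k) ^ 2
      ≤ ∑ j ∈ Finset.range J, 2 / (1 - r) *
          ∑ k ∈ Finset.range N, r ^ ((j - k) + (k - j)) * b k ^ 2 := by
        refine Finset.sum_le_sum fun j _ => ?_
        refine (Finset.sum_sq_le_sum_mul_sum_of_sq_le_mul (Finset.range N)
          (f := fun k => r ^ ((j - k) + (k - j)))
          (g := fun k => r ^ ((j - k) + (k - j)) * b k ^ 2)
          (fun k _ => pow_nonneg hr0 _) (fun k _ => by positivity)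
          (fun k _ => le_of_eq (by ring))).trans ?_
        exact mul_le_mul_of_nonneg_right (sum_range_pow_dist_le hr0 hr1 j N)
          (Finset.sum_nonneg fun k _ => by positivity)
    _ = 2 / (1 - r) * ∑ k ∈ Finset.range N,
          (∑ j ∈ Finset.range J, r ^ ((k - j) + (j - k))) * b k ^ 2 := by
        rw [← Finset.mul_sum, Finset.sum_comm]
        simp_rw [Finset.sum_mul]
        congr 1
        refine Finset.sum_congr rfl fun k _ => Finset.sum_congr rfl fun j _ => ?_
        rw [add_comm]
    _ ≤ 2 / (1 - r) * ∑ k ∈ Finset.range N, 2 / (1 - r) * b k ^ 2 := by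
        gcongr with k _
        exact sum_range_pow_dist_le hr0 hr1 k J
    _ = _ := by rw [← Finset.mul_sum]; ring

section Commuting

variable {X : Type*} [NormedAddCommGroup X] [NormedSpace ℂ X]

/-- The products `R₀² R₁² ⋯ R_{k-1}²`. -/
noncomputable def sqProd (R : ℕ → X →L[ℂ] X) : ℕ → X →L[ℂ] X
  | 0 => 1
  | k + 1 => sqProd R k * (R k * R k)

theorem sqProd_commute {R : ℕ → X →L[ℂ] X} {S : X →L[ℂ] X} (hS : ∀ i, Commute S (R i)) (k : ℕ) :
    Commute S (sqProd R k) := by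
  induction k with
  | zero => exact Commute.one_right _
  | succ k ih => exact ih.mul_right ((hS k).mul_right (hS k))

theorem norm_sqProd_le {R : ℕ → X →L[ℂ] X} (hR : ∀ k x, ‖R k x‖ ≤ ‖x‖) (k : ℕ) (x : X) :
    ‖sqProd R k x‖ ≤ ‖x‖ := by
  induction k generalizing x with
  | zero => exact le_rfl
  | succ k ih => exact (ih _).trans ((hR _ _).trans (hR _ _))

/-- Differences `R₀² ⋯ R_{k-2}² R_{k-1} (1 - R_k²)`. -/
noncomputable def sqDiff (R : ℕ → X →L[ℂ] X) : ℕ → X →L[ℂ] X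
  | 0 => 1 - R 0 * R 0
  | k + 1 => (1 - R (k + 1) * R (k + 1)) * (sqProd R k * R k)

/-- `sqDiff` holds back one factor `R i` from the increment of the products. That factor is what the
coarse-scale hypothesis later acts on. -/
theorem sqProd_sub_succ {R : ℕ → X →L[ℂ] X} (hRR : ∀ i k, Commute (R i) (R k)) (i : ℕ) :
    sqProd R (i + 1) - sqProd R (i + 1 + 1) = R i * sqDiff R (i + 1) := by
  have h1 : Commute (R i) (sqProd R i) := sqProd_commute (fun m => hRR i m) i
  have h2 : Commute (R i) (R (i + 1) * R (i + 1)) := (hRR i (i + 1)).mul_right (hRR i (i + 1))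
  have h3 : Commute (sqProd R i * (R i * R i)) (R (i + 1) * R (i + 1)) := by
    have h4 : Commute (R (i + 1)) (sqProd R i * (R i * R i)) :=
      sqProd_commute (fun m => hRR (i + 1) m) (i + 1)
    exact (h4.mul_left h4).symm
  have h5 : R i * sqDiff R (i + 1) =
      (1 - R (i + 1) * R (i + 1)) * (sqProd R i * (R i * R i)) := by
    change R i * ((1 - R (i + 1) * R (i + 1)) * (sqProd R i * R i)) = _
    have h6 : Commute (R i) (1 - R (i + 1) * R (i + 1)) := (Commute.one_right _).sub_right h2
    rw [← mul_assoc, h6.eq, mul_assoc, ← mul_assoc (R i), h1.eq, mul_assoc]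
  rw [h5, sub_mul, one_mul, ← h3.eq]; rfl

/-- Put y = `sqProd R i (R i x)`. By `hconv` a term costs at most ‖y‖² - ‖R_{i+1}² y‖². Since
`sqProd R (i + 2) (R (i + 2) x)` is R_i R_{i+2} applied to R_{i+1}² y, the sum telescopes in steps
of two. The two initial values and the term k = 0 make up the 3. -/
theorem sum_sqDiff_le {R : ℕ → X →L[ℂ] X} {c : ℝ} (hc : 0 ≤ c) (hR : ∀ k x, ‖R k x‖ ≤ ‖x‖)
    (hRR : ∀ i k, Commute (R i) (R k))
    (hconv : ∀ k x, c * ‖x - R k (R k x)‖ ^ 2 ≤ ‖x‖ ^ 2 - ‖R k (R k x)‖ ^ 2) (N : ℕ) (x : X) :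
    c * ∑ k ∈ Finset.range N, ‖sqDiff R k x‖ ^ 2 ≤ 3 * ‖x‖ ^ 2 := by
  set α : ℕ → ℝ := fun i => ‖sqProd R i (R i x)‖ ^ 2 with hα
  have hα1 : ∀ i, α i ≤ ‖x‖ ^ 2 := fun i => by
    have := (norm_sqProd_le hR i (R i x)).trans (hR i x)
    exact pow_le_pow_left₀ (norm_nonneg _) this 2
  have hstep : ∀ i, c * ‖sqDiff R (i + 1) x‖ ^ 2 ≤ α i - α (i + 2) := by
    intro i
    refine (hconv (i + 1) (sqProd R i (R i x))).trans (sub_le_sub_left ?_ _)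
    refine pow_le_pow_left₀ (norm_nonneg _) ?_ 2
    have hcomm : sqProd R (i + 2) * R (i + 2) =
        R i * R (i + 2) * (R (i + 1) * R (i + 1) * (sqProd R i * R i)) := by
      have hP : ∀ k, Commute (R k) (sqProd R i) := fun k => sqProd_commute (fun i => hRR k i) i
      have hY : Commute (R (i + 1)) (sqProd R i * R i) := (hP _).mul_right (hRR _ _)
      have hd : Commute (R (i + 2)) (R (i + 1) * R (i + 1) * (sqProd R i * R i)) :=
        ((hRR _ _).mul_right (hRR _ _)).mul_right ((hP _).mul_right (hRR _ _))
      calc sqProd R (i + 2) * R (i + 2)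
          = sqProd R i * (R i * R i) * (R (i + 1) * R (i + 1)) * R (i + 2) := rfl
        _ = R i * (sqProd R i * R i) * (R (i + 1) * R (i + 1)) * R (i + 2) := by
            rw [← mul_assoc (R i) (sqProd R i), (hP i).eq]
            simp only [mul_assoc]
        _ = R i * ((R (i + 1) * R (i + 1) * (sqProd R i * R i)) * R (i + 2)) := by
            rw [mul_assoc (R i), ← (hY.mul_left hY).eq, mul_assoc]
        _ = _ := by rw [← hd.eq, ← mul_assoc]
    have : sqProd R (i + 2) (R (i + 2) x) =
        R i (R (i + 2) (R (i + 1) (R (i + 1) (sqProd R i (R i x))))) :=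
      congrArg (fun S : X →L[ℂ] X => S x) hcomm
    rw [this]
    exact (hR _ _).trans (hR _ _)
  have hsum : ∀ N, c * ∑ k ∈ Finset.range N, ‖sqDiff R (k + 1) x‖ ^ 2 + α N + α (N + 1) ≤
      α 0 + α 1 := by
    intro N
    induction N with
    | zero => simp
    | succ N ih =>
      rw [Finset.sum_range_succ, mul_add]
      have := hstep N
      linarith
  have h0 : c * ‖sqDiff R 0 x‖ ^ 2 ≤ ‖x‖ ^ 2 :=
    (hconv 0 x).trans (sub_le_self _ (by positivity))
  have hNle : ∑ k ∈ Finset.range N, ‖sqDiff R k x‖ ^ 2 ≤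
      ∑ k ∈ Finset.range (N + 1), ‖sqDiff R k x‖ ^ 2 :=
    Finset.sum_le_sum_of_subset_of_nonneg (Finset.range_mono (by omega))
      fun _ _ _ => by positivity
  refine (mul_le_mul_of_nonneg_left hNle hc).trans ?_
  rw [Finset.sum_range_succ', mul_add]
  have h1 := hsum N
  have h2 : 0 ≤ α N := by positivity
  have h3 : 0 ≤ α (N + 1) := by positivity
  linarith [hα1 0, hα1 1]

/-- The approximations `1 - (1 - R₀² ⋯ R_{k-1}²)²` of the identity. -/
noncomputable def sqApprox (R : ℕ → X →L[ℂ] X) (k : ℕ) : X →L[ℂ] X :=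
  1 - (1 - sqProd R k) * (1 - sqProd R k)

/-- With P_k = `sqProd R k`, 1 - P_{k+1} = (1 - P_k) + (1 - R_k)(1 + R_k) P_k. Each step adds 2a
r^(j-k), and the induction reproduces the sum 2a/(1-r) of the series exactly. -/
theorem norm_comp_one_sub_sqProd_le {R : ℕ → X →L[ℂ] X} {S : X →L[ℂ] X} {a r : ℝ} (ha : 0 ≤ a)
    (hr0 : 0 < r) (hr1 : r < 1) (hR : ∀ k x, ‖R k x‖ ≤ ‖x‖) (hRR : ∀ i k, Commute (R i) (R k))
    {j : ℕ} (hfine : ∀ k x, k ≤ j → ‖S (x - R k x)‖ ≤ a * r ^ (j - k) * ‖x‖)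
    (k : ℕ) (hk : k ≤ j + 1) (x : X) :
    ‖S (x - sqProd R k x)‖ ≤ 2 * a / (1 - r) * r ^ (j + 1 - k) * ‖x‖ := by
  have hr : 0 < 1 - r := by linarith
  induction k generalizing x with
  | zero =>
    have : x - sqProd R 0 x = 0 := sub_self x
    rw [this, map_zero, norm_zero]; positivity
  | succ k ih =>
    have hcomm : ∀ y, sqProd R k (R k y) = R k (sqProd R k y) := fun y =>
      (congrArg (fun T : X →L[ℂ] X => T y) (sqProd_commute (fun i => hRR k i) k).eq).symm
    set y := sqProd R k x with hy
    have hy' : ‖y‖ ≤ ‖x‖ := norm_sqProd_le hR k x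
    have heq : x - sqProd R (k + 1) x = (x - sqProd R k x) + ((y + R k y) - R k (y + R k y)) := by
      have : sqProd R (k + 1) x = R k (R k y) := by
        change sqProd R k (R k (R k x)) = _
        rw [hcomm, hcomm]
      rw [this, map_add, hy]; abel
    rw [heq, map_add]
    have h1 := ih (by omega) x
    have h2 := hfine k (y + R k y) (by omega)
    have h3 : ‖y + R k y‖ ≤ 2 * ‖x‖ :=
      (norm_add_le _ _).trans (by linarith [hR k y])
    have hp : r ^ (j + 1 - k) = r * r ^ (j - k) := by
      rw [← pow_succ']; congr 1; omega
    have hp2 : j + 1 - (k + 1) = j - k := by omega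
    rw [hp] at h1
    rw [hp2]
    have h4 : a * r ^ (j - k) * ‖y + R k y‖ ≤ a * r ^ (j - k) * (2 * ‖x‖) := by gcongr
    calc _ ≤ 2 * a / (1 - r) * (r * r ^ (j - k)) * ‖x‖ + a * r ^ (j - k) * (2 * ‖x‖) :=
          (norm_add_le _ _).trans (add_le_add h1 (h2.trans h4))
      _ = _ := by field_simp; ring

/-- With P_k = `sqProd R k`, the difference is ((1 - P_k) + (1 - P_{k+1}))(P_k - P_{k+1}). For k ≤ j
the first factor is small under `S`; for k > j the second contains the held-back `R (k - 1)`. The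
square in `sqApprox` is there to produce the first factor. -/
theorem norm_comp_sqApprox_sub_le {R : ℕ → X →L[ℂ] X} {S : X →L[ℂ] X} {a r : ℝ} (ha : 0 ≤ a)
    (hr0 : 0 < r) (hr1 : r < 1) (hR : ∀ k x, ‖R k x‖ ≤ ‖x‖) (hRR : ∀ i k, Commute (R i) (R k))
    {j : ℕ} (hfine : ∀ k x, k ≤ j → ‖S (x - R k x)‖ ≤ a * r ^ (j - k) * ‖x‖)
    (hcoarse : ∀ k x, j ≤ k → ‖S (R k x)‖ ≤ a * r ^ (k - j) * ‖x‖) (k : ℕ) (x : X) :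
    ‖S ((sqApprox R k - sqApprox R (k + 1)) x)‖ ≤
      4 * a / (r * (1 - r)) * (r ^ ((j - k) + (k - j)) * ‖sqDiff R k x‖) := by
  have hr : 0 < 1 - r := by linarith
  have hPP : ∀ i l, Commute (sqProd R i) (sqProd R l) := fun i l =>
    sqProd_commute (fun m => (sqProd_commute (fun i => hRR m i) i).symm) l
  have hfact : sqApprox R k - sqApprox R (k + 1) =
      (2 - sqProd R k - sqProd R (k + 1)) * (sqProd R k - sqProd R (k + 1)) := by
    have := (hPP k (k + 1)).eq
    simp only [sqApprox]
    noncomm_ring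
    rw [this]; abel
  set U : X →L[ℂ] X := 2 - sqProd R k - sqProd R (k + 1) with hU
  have hUx : ∀ y, U y = (y - sqProd R k y) + (y - sqProd R (k + 1) y) := fun y => by
    have h2 : (2 : X →L[ℂ] X) = 1 + 1 := one_add_one_eq_two.symm
    rw [hU, h2]
    simp only [sub_apply, add_apply,
      one_apply_eq_self]
    abel
  rcases le_or_gt k j with hkj | hkj
  · have hD : ‖(sqProd R k - sqProd R (k + 1)) x‖ ≤ ‖sqDiff R k x‖ := by
      cases k with
      | zero => exact le_rfl
      | succ i =>
        rw [sqProd_sub_succ hRR]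
        exact hR i _
    rw [hfact]
    set y := (sqProd R k - sqProd R (k + 1)) x with hy
    change ‖S (U y)‖ ≤ _
    rw [hUx, map_add]
    have h1 := norm_comp_one_sub_sqProd_le ha hr0 hr1 hR hRR hfine k (by omega) y
    have h2 := norm_comp_one_sub_sqProd_le ha hr0 hr1 hR hRR hfine (k + 1) (by omega) y
    have hp : r ^ (j + 1 - k) ≤ r ^ (j - k) := pow_le_pow_of_le_one hr0.le hr1.le (by omega)
    have hp2 : j + 1 - (k + 1) = j - k := by omega
    have hp3 : (j - k) + (k - j) = j - k := by omega
    rw [hp2] at h2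
    rw [hp3]
    have h3 : 2 * a / (1 - r) * r ^ (j + 1 - k) * ‖y‖ ≤ 2 * a / (1 - r) * r ^ (j - k) * ‖y‖ := by
      gcongr
    have h4 : 4 * a / (1 - r) ≤ 4 * a / (r * (1 - r)) := by
      apply div_le_div_of_nonneg_left (by positivity) (by positivity)
      nlinarith
    calc _ ≤ 2 * a / (1 - r) * r ^ (j - k) * ‖y‖ + 2 * a / (1 - r) * r ^ (j - k) * ‖y‖ :=
          (norm_add_le _ _).trans (add_le_add (h1.trans h3) h2)
      _ = 4 * a / (1 - r) * (r ^ (j - k) * ‖y‖) := by ring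
      _ ≤ _ := by gcongr
  · obtain ⟨i, rfl⟩ : ∃ i, k = i + 1 := ⟨k - 1, by omega⟩
    have hRU : Commute (R i) U := by
      have h1 : ∀ m, Commute (R i) (sqProd R m) := fun m => sqProd_commute (fun l => hRR i l) m
      exact ((Commute.ofNat_right (R i) 2).sub_right (h1 _)).sub_right (h1 _)
    have hD := sqProd_sub_succ hRR i
    have heq : (sqApprox R (i + 1) - sqApprox R (i + 1 + 1)) x = R i (U (sqDiff R (i + 1) x)) := by
      rw [hfact, hD, ← mul_assoc, ← hRU.eq]; rfl
    rw [heq]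
    have h1 := hcoarse i (U (sqDiff R (i + 1) x)) (by omega)
    set y := sqDiff R (i + 1) x
    have h2 : ‖U y‖ ≤ 4 * ‖y‖ := by
      rw [hUx]
      have := norm_sqProd_le hR (i + 1) y
      have := norm_sqProd_le hR (i + 1 + 1) y
      have := norm_sub_le y (sqProd R (i + 1) y)
      have := norm_sub_le y (sqProd R (i + 1 + 1) y)
      have := norm_add_le (y - sqProd R (i + 1) y) (y - sqProd R (i + 1 + 1) y)
      linarith
    -- The decay comes from `R i`, one index below k = i + 1; the missing power of `r` is the 1/r in
    -- the constant.
    have hp : r ^ ((j - (i + 1)) + (i + 1 - j)) = r * r ^ (i - j) := by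
      rw [← pow_succ']; congr 1; omega
    rw [hp]
    calc _ ≤ a * r ^ (i - j) * (4 * ‖y‖) := h1.trans (by gcongr)
      _ = 4 * a * (r ^ (i - j) * ‖y‖) := by ring
      _ ≤ 4 * a / (1 - r) * (r ^ (i - j) * ‖y‖) := by
        gcongr
        rw [le_div_iff₀ hr]; nlinarith
      _ = _ := by field_simp

/-- Almost orthogonality: if the `T j` are adapted to the scales of the commuting contractions `R k`,
then `x ↦ (T j x)_j` is square-summable. -/
theorem sum_norm_sq_le_of_adapted {R T : ℕ → X →L[ℂ] X} {a r c : ℝ} (ha : 0 ≤ a)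
    (hr0 : 0 < r) (hr1 : r < 1) (hc : 0 < c) (hR : ∀ k x, ‖R k x‖ ≤ ‖x‖)
    (hRR : ∀ i k, Commute (R i) (R k))
    (hconv : ∀ k x, c * ‖x - R k (R k x)‖ ^ 2 ≤ ‖x‖ ^ 2 - ‖R k (R k x)‖ ^ 2)
    (hfine : ∀ j k x, k ≤ j → ‖T j (x - R k x)‖ ≤ a * r ^ (j - k) * ‖x‖)
    (hcoarse : ∀ j k x, j ≤ k → ‖T j (R k x)‖ ≤ a * r ^ (k - j) * ‖x‖) (J : ℕ) (x : X) :
    ∑ j ∈ Finset.range J, ‖T j x‖ ^ 2 ≤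
      (4 * a / (r * (1 - r))) ^ 2 * ((2 / (1 - r)) ^ 2 * (3 / c)) * ‖x‖ ^ 2 := by
  have hr : 0 < 1 - r := by linarith
  set K := 4 * a / (r * (1 - r)) with hK
  have hK0 : 0 ≤ K := by positivity
  have htel : ∀ j N, T j x - T j (sqApprox R N x) =
      ∑ k ∈ Finset.range N, T j ((sqApprox R k - sqApprox R (k + 1)) x) := by
    intro j N
    have h0 : sqApprox R 0 x = x := by
      simp [sqApprox, sqProd]
    simp only [sub_apply, map_sub]
    rw [Finset.sum_range_sub' (fun k => T j (sqApprox R k x)), h0]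
  have hbound : ∀ N, ∑ j ∈ Finset.range J, ‖T j x - T j (sqApprox R N x)‖ ^ 2 ≤
      K ^ 2 * ((2 / (1 - r)) ^ 2 * (3 / c)) * ‖x‖ ^ 2 := by
    intro N
    have h1 : ∀ j, ‖T j x - T j (sqApprox R N x)‖ ^ 2 ≤
        K ^ 2 * (∑ k ∈ Finset.range N, r ^ ((j - k) + (k - j)) * ‖sqDiff R k x‖) ^ 2 := by
      intro j
      rw [htel, ← mul_pow]
      refine pow_le_pow_left₀ (norm_nonneg _) ((norm_sum_le _ _).trans ?_) 2
      rw [Finset.mul_sum]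
      exact Finset.sum_le_sum fun k _ =>
        norm_comp_sqApprox_sub_le ha hr0 hr1 hR hRR (hfine j) (hcoarse j) k x
    refine (Finset.sum_le_sum fun j _ => h1 j).trans ?_
    rw [← Finset.mul_sum, mul_assoc, mul_assoc]
    have h2 := sum_sqDiff_le hc.le hR hRR hconv N x
    have h3 : ∑ k ∈ Finset.range N, ‖sqDiff R k x‖ ^ 2 ≤ 3 / c * ‖x‖ ^ 2 := by
      rw [div_mul_eq_mul_div, le_div_iff₀ hc]; linarith
    gcongr
    exact (schur_range hr0.le hr1 J N _).trans (by gcongr)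
  -- `sqApprox R N` is P_N(2 - P_N) with P_N = `sqProd R N`, so it contains `R (N - 1)`, which
  -- `hcoarse` makes small under `T j`. Convergence of `sqApprox R N x` itself is not needed.
  have hlim : ∀ j, Filter.Tendsto (fun N => T j (sqApprox R N x)) Filter.atTop (nhds 0) := by
    intro j
    rw [← Filter.tendsto_add_atTop_iff_nat (j + 1)]
    have hz : ∀ i, sqApprox R (i + (j + 1)) x = R (i + j) (R (i + j) (sqProd R (i + j)
        (x + (x - sqProd R (i + j + 1) x)))) := by
      intro i
      have h1 : sqApprox R (i + (j + 1)) =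
          sqProd R (i + j + 1) * (1 + (1 - sqProd R (i + j + 1))) := by
        simp only [sqApprox, ← add_assoc]; noncomm_ring
      have h2 : Commute (R (i + j)) (sqProd R (i + j)) := sqProd_commute (fun l => hRR _ l) _
      have h3 : sqProd R (i + j + 1) = R (i + j) * (R (i + j) * sqProd R (i + j)) := by
        rw [h2.eq, ← mul_assoc, h2.eq, mul_assoc]; rfl
      rw [h1]
      nth_rewrite 1 [h3]
      rfl
    refine squeeze_zero_norm (a := fun i => a * r ^ i * (3 * ‖x‖)) (fun i => ?_) ?_
    · rw [hz]
      refine (hcoarse j (i + j) _ (by omega)).trans ?_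
      rw [Nat.add_sub_cancel]
      have h1 := norm_sqProd_le hR (i + j + 1) x
      have h2 := norm_sub_le x (sqProd R (i + j + 1) x)
      have h3 := norm_add_le x (x - sqProd R (i + j + 1) x)
      have h4 := (hR (i + j) (sqProd R (i + j) (x + (x - sqProd R (i + j + 1) x)))).trans
        (norm_sqProd_le hR _ _)
      gcongr
      linarith
    · have := (tendsto_pow_atTop_nhds_zero_of_lt_one hr0.le hr1).const_mul a
      simpa using this.mul_const (3 * ‖x‖)
  have hlim2 : Filter.Tendsto
      (fun N => ∑ j ∈ Finset.range J, ‖T j x - T j (sqApprox R N x)‖ ^ 2) Filter.atTop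
      (nhds (∑ j ∈ Finset.range J, ‖T j x‖ ^ 2)) := by
    refine tendsto_finsetSum _ fun j _ => ?_
    have := ((tendsto_const_nhds (x := T j x)).sub (hlim j)).norm.pow 2
    rwa [sub_zero] at this
  exact le_of_tendsto' hlim2 hbound

end Commuting

/-! ### Averages of an isometric representation -/

/-- A strongly continuous isometric representation of the additive group `E` on `X`. -/
structure IsometricRep (E X : Type*) [NormedAddCommGroup E] [NormedAddCommGroup X]
    [NormedSpace ℂ X] where
  toFun : E → X →L[ℂ] X
  map_zero' : ∀ x, toFun 0 x = x
  map_add' : ∀ a b x, toFun (a + b) x = toFun a (toFun b x)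
  norm_map' : ∀ a x, ‖toFun a x‖ = ‖x‖
  continuous' : ∀ x, Continuous fun a => toFun a x

namespace IsometricRep

variable {E X : Type*} [NormedAddCommGroup E] [NormedAddCommGroup X] [NormedSpace ℂ X]

/-- Precomposition of a representation with a homothety. -/
def scale [NormedSpace ℝ E] (τ : IsometricRep E X) (s : ℝ) : IsometricRep E X where
  toFun a := τ.toFun (s • a)
  map_zero' x := by rw [smul_zero, τ.map_zero']
  map_add' a b x := by rw [smul_add, τ.map_add']
  norm_map' a x := τ.norm_map' _ x
  continuous' x := (τ.continuous' x).comp (continuous_const_smul s)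

variable [NormedSpace ℝ E]

theorem continuous_smul_apply (τ : IsometricRep E X) (s : ℝ) (x : X) :
    Continuous fun u => τ.toFun (s • u) x :=
  (τ.continuous' x).comp (continuous_const_smul s)

variable [MeasureSpace E]

/-- The average `∫ g(u) τ(s u) x du`. -/
noncomputable def avg (τ : IsometricRep E X) (g : E → ℂ) (s : ℝ) (x : X) : X :=
  ∫ u, g u • τ.toFun (s • u) x

theorem avg_scale (τ : IsometricRep E X) (g : E → ℂ) (r s : ℝ) (x : X) :
    (τ.scale r).avg g s x = τ.avg g (r * s) x := by
  simp only [avg, scale, smul_smul]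

theorem norm_avg_le (τ : IsometricRep E X) (g : E → ℂ) (s : ℝ) (x : X) :
    ‖τ.avg g s x‖ ≤ (∫ u, ‖g u‖) * ‖x‖ := by
  refine (norm_integral_le_integral_norm _).trans (le_of_eq ?_)
  simp_rw [norm_smul, τ.norm_map', integral_mul_const]

variable [BorelSpace E] [FiniteDimensional ℝ E]

theorem integrable_smul_bounded {g : E → ℂ} (hg : Integrable g) {F : E → X} (hF : Continuous F)
    {C : ℝ} (hC : ∀ u, ‖F u‖ ≤ C) : Integrable (fun u => g u • F u) := by
  have := FiniteDimensional.proper ℝ E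
  exact hg.smul_bdd C hF.aestronglyMeasurable (.of_forall hC)

theorem integrable_mul_norm_sq {ρ : E → ℝ} (hρ : Integrable ρ) {Y : Type*}
    [NormedAddCommGroup Y] {F : E → Y} (hF : Continuous F)
    {C : ℝ} (hC : ∀ u, ‖F u‖ ≤ C) : Integrable (fun u => ρ u * ‖F u‖ ^ 2) := by
  have := FiniteDimensional.proper ℝ E
  refine hρ.smul_bdd (f := fun u => ‖F u‖ ^ 2) (C ^ 2) (hF.norm.pow 2).aestronglyMeasurable
    (.of_forall fun u => ?_)
  rw [norm_pow, norm_norm]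
  exact pow_le_pow_left₀ (norm_nonneg _) (hC u) 2

/-- Jensen's inequality, obtained by integrating 2m‖F‖ ≤ m² + ‖F‖² against ρ, with m the norm of the
mean. -/
theorem norm_integral_smul_sq_le {ρ : E → ℝ} (hρ : Integrable ρ) (hρ0 : ∀ u, 0 ≤ ρ u)
    (hρ1 : ∫ u, ρ u = 1) {F : E → X} (hF : Continuous F) {C : ℝ} (hC : ∀ u, ‖F u‖ ≤ C) :
    ‖∫ u, (ρ u : ℂ) • F u‖ ^ 2 ≤ ∫ u, ρ u * ‖F u‖ ^ 2 := by
  have := FiniteDimensional.proper ℝ E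
  have hi1 : Integrable (fun u => ρ u * ‖F u‖) := by
    have := hρ.smul_bdd C hF.norm.aestronglyMeasurable (.of_forall fun u => by simpa using hC u)
    exact this
  have hi2 := integrable_mul_norm_sq hρ hF hC
  set m := ‖∫ u, (ρ u : ℂ) • F u‖ with hm
  have h1 : m ≤ ∫ u, ρ u * ‖F u‖ := by
    refine (norm_integral_le_integral_norm _).trans (le_of_eq (integral_congr_ae ?_))
    exact .of_forall fun u => by
      simp only [norm_smul, Complex.norm_real, Real.norm_of_nonneg (hρ0 u)]
  have h2 : ∫ u, 2 * m * (ρ u * ‖F u‖) ≤ ∫ u, (m ^ 2 * ρ u + ρ u * ‖F u‖ ^ 2) := by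
    refine integral_mono (hi1.const_mul _) ((hρ.const_mul _).add hi2) fun u => ?_
    have := mul_nonneg (hρ0 u) (sq_nonneg (m - ‖F u‖))
    simp only
    nlinarith
  rw [integral_const_mul, integral_add (hρ.const_mul _) hi2, integral_const_mul, hρ1] at h2
  have hm0 : 0 ≤ m := norm_nonneg _
  nlinarith

theorem integrable_avg (τ : IsometricRep E X) {g : E → ℂ} (hg : Integrable g) (s : ℝ) (x : X) :
    Integrable (fun u => g u • τ.toFun (s • u) x) :=
  integrable_smul_bounded hg (τ.continuous_smul_apply s x) (fun _ => (τ.norm_map' _ x).le)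

/-- `avg` as a continuous linear map. -/
noncomputable def avgL (τ : IsometricRep E X) {g : E → ℂ} (hg : Integrable g) (s : ℝ) : X →L[ℂ] X :=
  LinearMap.mkContinuous
    { toFun := τ.avg g s
      map_add' := fun x y => by
        simp only [avg, map_add, smul_add]
        exact integral_add (τ.integrable_avg hg s x) (τ.integrable_avg hg s y)
      map_smul' := fun a x => by
        simp only [avg, map_smul, smul_comm _ a, integral_smul, RingHom.id_apply] }
    (∫ u, ‖g u‖) (fun x => τ.norm_avg_le g s x)

@[simp] theorem avgL_apply (τ : IsometricRep E X) {g : E → ℂ} (hg : Integrable g) (s : ℝ) (x : X) :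
    τ.avgL hg s x = τ.avg g s x := rfl

theorem continuous_avg (τ : IsometricRep E X) {g : E → ℂ} (hg : Integrable g) :
    Continuous fun z : ℝ × X => τ.avg g z.1 z.2 := by
  have h1 : ∀ x, Continuous fun s => τ.avg g s x := fun x => by
    refine continuous_of_dominated (bound := fun u => ‖g u‖ * ‖x‖)
      (fun s => (τ.integrable_avg hg s x).aestronglyMeasurable)
      (fun s => .of_forall fun u => by rw [norm_smul, τ.norm_map']) (hg.norm.mul_const _)
      (.of_forall fun u => ?_)
    exact continuous_const.smul ((τ.continuous' x).comp (continuous_id.smul continuous_const))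
  refine continuous_iff_continuousAt.2 fun ⟨s, x⟩ => ?_
  rw [ContinuousAt, tendsto_iff_norm_sub_tendsto_zero]
  have hlim : Filter.Tendsto (fun z : ℝ × X => (∫ u, ‖g u‖) * ‖z.2 - x‖ +
      ‖τ.avg g z.1 x - τ.avg g s x‖) (nhds (s, x)) (nhds 0) := by
    have hc : Continuous (fun z : ℝ × X => (∫ u, ‖g u‖) * ‖z.2 - x‖ +
        ‖τ.avg g z.1 x - τ.avg g s x‖) := by
      have := (h1 x).comp (continuous_fst (X := ℝ) (Y := X))
      exact (continuous_const.mul (continuous_snd.sub continuous_const).norm).add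
        (this.sub continuous_const).norm
    simpa using hc.tendsto (s, x)
  refine squeeze_zero (fun _ => norm_nonneg _) (fun z => ?_) hlim
  have : τ.avg g z.1 z.2 - τ.avg g s x =
      τ.avg g z.1 (z.2 - x) + (τ.avg g z.1 x - τ.avg g s x) := by
    rw [← avgL_apply τ hg z.1 (z.2 - x), map_sub]; simp
  rw [this]
  exact (norm_add_le _ _).trans (add_le_add (τ.norm_avg_le g _ _) le_rfl)

variable [CompleteSpace X]

theorem avg_comp_clm (τ : IsometricRep E X) {g : E → ℂ} (hg : Integrable g) (s : ℝ) (x : X)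
    {Y : Type*} [NormedAddCommGroup Y] [NormedSpace ℂ Y] [CompleteSpace Y] (L : X →L[ℂ] Y) :
    L (τ.avg g s x) = ∫ u, g u • L (τ.toFun (s • u) x) := by
  rw [avg, ← L.integral_comp_comm (τ.integrable_avg hg s x)]
  simp only [map_smul]

theorem map_avg (τ : IsometricRep E X) {g : E → ℂ} (hg : Integrable g) (s : ℝ) (a : E) (x : X) :
    τ.toFun a (τ.avg g s x) = τ.avg g s (τ.toFun a x) := by
  rw [avg_comp_clm τ hg]
  simp only [avg, ← τ.map_add', add_comm a]

theorem avg_comm (τ : IsometricRep E X) {g h : E → ℂ} (hg : Integrable g) (hh : Integrable h)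
    (s t : ℝ) (x : X) : τ.avg g s (τ.avg h t x) = τ.avg h t (τ.avg g s x) := by
  rw [← avgL_apply τ hg s (τ.avg h t x), avg_comp_clm τ hh]
  simp only [avgL_apply, ← map_avg τ hg]
  rfl

variable [(volume : Measure E).IsAddHaarMeasure]

/-- Moving an average by s • a only translates its kernel by a, so the L¹ modulus of continuity of
the kernel controls the change. -/
theorem norm_map_avg_sub_le (τ : IsometricRep E X) {g : E → ℂ} (hg : Integrable g) (s : ℝ) (a : E)
    (x : X) : ‖τ.toFun (s • a) (τ.avg g s x) - τ.avg g s x‖ ≤ (∫ u, ‖g (u - a) - g u‖) * ‖x‖ := by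
  have h1 : τ.toFun (s • a) (τ.avg g s x) = τ.avg (fun u => g (u - a)) s x := by
    rw [avg_comp_clm τ hg, avg,
      ← integral_sub_right_eq_self (fun u => g u • τ.toFun (s • a) (τ.toFun (s • u) x)) a]
    refine integral_congr_ae (.of_forall fun u => ?_)
    simp only [← τ.map_add', ← smul_add, add_sub_cancel]
  have h2 : τ.avg (fun u => g (u - a)) s x - τ.avg g s x = τ.avg (fun u => g (u - a) - g u) s x := by
    simp only [avg, sub_smul]
    exact (integral_sub (τ.integrable_avg (hg.comp_sub_right a) s x) (τ.integrable_avg hg s x)).symm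
  rw [h1, h2]
  exact τ.norm_avg_le _ s x

/-- Averages of a mean zero kernel at scale `s` nearly vanish on averages at a larger scale `t`. -/
theorem norm_avg_avg_le (τ : IsometricRep E X) {ψ χ : E → ℂ} (hψ : Integrable ψ)
    (hψ0 : ∫ u, ψ u = 0) (hχ : Integrable χ) {L δ M : ℝ} (hL : 0 ≤ L)
    (hmod : ∀ a, ∫ u, ‖χ (u - a) - χ u‖ ≤ L * ‖a‖ ^ δ)
    (hMi : Integrable fun u => ‖ψ u‖ * ‖u‖ ^ δ) (hM : ∫ u, ‖ψ u‖ * ‖u‖ ^ δ ≤ M)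
    {s t : ℝ} (hs : 0 < s) (ht : 0 < t) (x : X) :
    ‖τ.avg ψ s (τ.avg χ t x)‖ ≤ L * M * (s / t) ^ δ * ‖x‖ := by
  set y := τ.avg χ t x with hy
  -- Mean zero of ψ allows y to be subtracted, and y, an average at scale t, barely moves under s •
  -- u = t • ((s/t) • u).
  have h1 : τ.avg ψ s y = ∫ u, ψ u • (τ.toFun (s • u) y - y) := by
    simp only [smul_sub]
    rw [integral_sub (τ.integrable_avg hψ s y) (hψ.smul_const y), integral_smul_const, hψ0,
      zero_smul, sub_zero]
    rfl
  have h2 : ∀ u, ‖τ.toFun (s • u) y - y‖ ≤ L * ((s / t) ^ δ * ‖u‖ ^ δ) * ‖x‖ := by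
    intro u
    have h3 : s • u = t • ((s / t) • u) := by rw [smul_smul, mul_div_cancel₀ _ ht.ne']
    rw [h3]
    refine (norm_map_avg_sub_le τ hχ t _ x).trans ?_
    gcongr
    refine (hmod _).trans (le_of_eq ?_)
    rw [norm_smul, Real.norm_of_nonneg (by positivity),
      Real.mul_rpow (by positivity) (norm_nonneg _)]
  rw [h1]
  refine (norm_integral_le_integral_norm _).trans ?_
  calc ∫ u, ‖ψ u • (τ.toFun (s • u) y - y)‖
      ≤ ∫ u, (‖ψ u‖ * ‖u‖ ^ δ) * (L * (s / t) ^ δ * ‖x‖) := by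
        refine integral_mono_of_nonneg (.of_forall fun _ => norm_nonneg _) (hMi.mul_const _)
          (.of_forall fun u => ?_)
        simp only [norm_smul]
        calc ‖ψ u‖ * ‖τ.toFun (s • u) y - y‖
            ≤ ‖ψ u‖ * (L * ((s / t) ^ δ * ‖u‖ ^ δ) * ‖x‖) := by gcongr; exact h2 u
          _ = _ := by ring
    _ = (∫ u, ‖ψ u‖ * ‖u‖ ^ δ) * (L * (s / t) ^ δ * ‖x‖) := integral_mul_const _ _
    _ ≤ M * (L * (s / t) ^ δ * ‖x‖) := by gcongr
    _ = _ := by ring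

/-- Averages of an `L¹`-Hölder kernel at scale `s` nearly absorb averages at a smaller scale `t`. -/
theorem norm_avg_sub_avg_le (τ : IsometricRep E X) {ψ χ : E → ℂ} (hψ : Integrable ψ)
    (hχ : Integrable χ) (hχ1 : ∫ u, χ u = 1) (hχn : ∫ u, ‖χ u‖ = 1)
    (hsupp : ∀ u, χ u ≠ 0 → ‖u‖ ≤ 1) {A η : ℝ} (hA : 0 ≤ A) (hη : 0 ≤ η)
    (hmod : ∀ a, ∫ u, ‖ψ (u - a) - ψ u‖ ≤ A * ‖a‖ ^ η)
    {s t : ℝ} (hs : 0 < s) (ht : 0 < t) (x : X) :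
    ‖τ.avg ψ s (x - τ.avg χ t x)‖ ≤ A * (t / s) ^ η * ‖x‖ := by
  -- Commuting the averages leaves the displacement of a ψ-average at scale s by t • v, with ‖v‖ ≤ 1
  -- on the support of χ.
  have h1 : τ.avg ψ s (x - τ.avg χ t x) =
      ∫ v, χ v • (τ.avg ψ s x - τ.toFun (t • v) (τ.avg ψ s x)) := by
    simp only [smul_sub]
    rw [integral_sub (hχ.smul_const _) (τ.integrable_avg hχ t _), integral_smul_const, hχ1,
      one_smul, ← avgL_apply τ hψ s (x - _), map_sub, avgL_apply, avgL_apply, avg_comm τ hψ hχ]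
    rfl
  have h2 : ∀ v, ‖v‖ ≤ 1 →
      ‖τ.avg ψ s x - τ.toFun (t • v) (τ.avg ψ s x)‖ ≤ A * (t / s) ^ η * ‖x‖ := by
    intro v hv
    have h3 : t • v = s • ((t / s) • v) := by rw [smul_smul, mul_div_cancel₀ _ hs.ne']
    rw [h3, norm_sub_rev]
    refine (norm_map_avg_sub_le τ hψ s _ x).trans ?_
    gcongr
    refine (hmod _).trans ?_
    rw [norm_smul, Real.norm_of_nonneg (by positivity)]
    gcongr
    exact mul_le_of_le_one_right (by positivity) hv
  rw [h1]
  refine (norm_integral_le_integral_norm _).trans ?_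
  calc ∫ v, ‖χ v • (τ.avg ψ s x - τ.toFun (t • v) (τ.avg ψ s x))‖
      ≤ ∫ v, ‖χ v‖ * (A * (t / s) ^ η * ‖x‖) := by
        refine integral_mono_of_nonneg (.of_forall fun _ => norm_nonneg _) (hχ.norm.mul_const _)
          (.of_forall fun v => ?_)
        simp only [norm_smul]
        by_cases hv : χ v = 0
        · simp [hv]
        · gcongr
          exact h2 v (hsupp v hv)
    _ = _ := by rw [integral_mul_const, hχn, one_mul]

/-- The defect of contractivity of a symmetric average controls the deviation from the identity. -/
theorem norm_sub_avg_avg_sq_le (τ : IsometricRep E X) {c : ℝ} (hc : 0 ≤ c)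
    (hX : TwoUniformlyConvex X c) {ρ : E → ℝ} (hρ : Integrable ρ) (hρ0 : ∀ u, 0 ≤ ρ u)
    (hρ1 : ∫ u, ρ u = 1) (hsymm : ∀ u, ρ (-u) = ρ u) (s : ℝ) (x : X) :
    2 * c * ‖x - τ.avg (fun u => (ρ u : ℂ)) s (τ.avg (fun u => (ρ u : ℂ)) s x)‖ ^ 2 ≤
      ‖x‖ ^ 2 - ‖τ.avg (fun u => (ρ u : ℂ)) s (τ.avg (fun u => (ρ u : ℂ)) s x)‖ ^ 2 := by
  have := FiniteDimensional.proper ℝ E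
  set χ : E → ℂ := fun u => (ρ u : ℂ) with hχdef
  have hχ : Integrable χ := hρ.ofReal
  have hχ1 : ∫ u, χ u = 1 := by rw [hχdef, integral_complex_ofReal, hρ1, Complex.ofReal_one]
  have hχn : ∫ u, ‖χ u‖ = 1 := by
    rw [← hρ1]
    exact integral_congr_ae (.of_forall fun u => by
      simp only [hχdef, Complex.norm_real, Real.norm_of_nonneg (hρ0 u)])
  have hcontr : ∀ y, ‖τ.avg χ s y‖ ≤ ‖y‖ := fun y => by
    simpa [hχn] using τ.norm_avg_le χ s y
  set y := τ.avg χ s x with hy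
  have hcont := τ.continuous_smul_apply s x
  have hbd : ∀ u, ‖τ.toFun (s • u) x‖ ≤ ‖x‖ := fun u => (τ.norm_map' _ x).le
  have hyx : ‖y‖ ≤ ‖x‖ := hcontr x
  -- Convexity is applied to y and τ(s u)x and averaged over u. The sums have mean 2y, which bounds
  -- their mean square from below.
  have hplus : (2 * ‖y‖) ^ 2 ≤ ∫ u, ρ u * ‖y + τ.toFun (s • u) x‖ ^ 2 := by
    have h := norm_integral_smul_sq_le hρ hρ0 hρ1 (F := fun u => y + τ.toFun (s • u) x)
      (continuous_const.add hcont) (C := ‖x‖ + ‖x‖)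
      (fun u => (norm_add_le _ _).trans (add_le_add hyx (hbd u)))
    have h2 : ∫ u, (ρ u : ℂ) • (y + τ.toFun (s • u) x) = (2 : ℂ) • y := by
      simp only [smul_add]
      rw [integral_add (hχ.smul_const y) (τ.integrable_avg hχ s x), integral_smul_const,
        show ∫ u, (ρ u : ℂ) = 1 from hχ1, one_smul, two_smul]
      rfl
    rw [h2, norm_smul] at h
    simpa using h
  -- The isometry τ(-s u) carries y - τ(s u)x to τ(-s u)y - x. By symmetry of ρ these have mean `avg
  -- χ s y - x`, which is why the average appears twice in the conclusion.
  have hminus : ‖x - τ.avg χ s y‖ ^ 2 ≤ ∫ u, ρ u * ‖y - τ.toFun (s • u) x‖ ^ 2 := by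
    have hF : ∀ u, τ.toFun (s • -u) (y - τ.toFun (s • u) x) = τ.toFun (s • -u) y - x := fun u => by
      rw [map_sub, ← τ.map_add', ← smul_add, neg_add_cancel, smul_zero, τ.map_zero']
    have hFc : Continuous fun u => τ.toFun (s • -u) y - x :=
      ((τ.continuous_smul_apply s y).comp continuous_neg).sub continuous_const
    have h := norm_integral_smul_sq_le hρ hρ0 hρ1 hFc (C := ‖x‖ + ‖x‖)
      (fun u => (norm_sub_le _ _).trans (add_le_add ((τ.norm_map' _ y).le.trans hyx) le_rfl))
    have h2 : ∫ u, (ρ u : ℂ) • (τ.toFun (s • -u) y - x) = τ.avg χ s y - x := by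
      simp only [smul_sub]
      rw [integral_sub, integral_smul_const, show ∫ u, (ρ u : ℂ) = 1 from hχ1, one_smul, avg,
        ← integral_neg_eq_self (fun u => χ u • τ.toFun (s • u) y)]
      · simp only [hχdef, hsymm]
      · exact integrable_smul_bounded hχ ((τ.continuous_smul_apply s y).comp continuous_neg)
          (fun u => (τ.norm_map' _ y).le)
      · exact hχ.smul_const x
    rw [h2, norm_sub_rev] at h
    refine h.trans (le_of_eq (integral_congr_ae (.of_forall fun u => ?_)))
    simp only [← hF, τ.norm_map']
  have hi1 := integrable_mul_norm_sq hρ (F := fun u => y + τ.toFun (s • u) x)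
    (continuous_const.add hcont)
    (fun u => (norm_add_le _ _).trans (add_le_add hyx (hbd u)))
  have hi2 := integrable_mul_norm_sq hρ (F := fun u => y - τ.toFun (s • u) x)
    (continuous_const.sub hcont)
    (fun u => (norm_sub_le _ _).trans (add_le_add hyx (hbd u)))
  have hint : ∫ u, (1 / 4 * (ρ u * ‖y + τ.toFun (s • u) x‖ ^ 2) +
      c * (ρ u * ‖y - τ.toFun (s • u) x‖ ^ 2)) ≤ ∫ u, ρ u * ((‖y‖ ^ 2 + ‖x‖ ^ 2) / 2) := by
    refine integral_mono ((hi1.const_mul _).add (hi2.const_mul _)) (hρ.mul_const _) fun u => ?_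
    have h := mul_le_mul_of_nonneg_left (hX y (τ.toFun (s • u) x)) (hρ0 u)
    rw [τ.norm_map'] at h
    simp only
    linarith
  rw [integral_add (hi1.const_mul _) (hi2.const_mul _), integral_const_mul, integral_const_mul,
    integral_mul_const, hρ1] at hint
  have h3 : ‖τ.avg χ s y‖ ^ 2 ≤ ‖y‖ ^ 2 := pow_le_pow_left₀ (norm_nonneg _) (hcontr y) 2
  have h4 := mul_le_mul_of_nonneg_left hminus hc
  nlinarith

end IsometricRep

/-! ### The normalized indicator of the unit ball -/

section Ball

variable (E : Type*) [NormedAddCommGroup E] [MeasureSpace E]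

/-- The normalized indicator function of the unit ball. -/
noncomputable def ballDensity : E → ℝ :=
  (Metric.ball (0 : E) 1).indicator fun _ => (volume.real (Metric.ball (0 : E) 1))⁻¹

theorem ballDensity_nonneg (u : E) : 0 ≤ ballDensity E u :=
  Set.indicator_nonneg (fun _ _ => by positivity) u

theorem ballDensity_neg (u : E) : ballDensity E (-u) = ballDensity E u := by
  simp only [ballDensity, Set.indicator, Metric.mem_ball, dist_zero_right, norm_neg]

theorem norm_le_one_of_ballDensity_ne_zero {u : E} (hu : ballDensity E u ≠ 0) : ‖u‖ ≤ 1 := by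
  have := Set.mem_of_indicator_ne_zero hu
  rw [mem_ball_zero_iff] at this
  exact this.le

variable [NormedSpace ℝ E] [FiniteDimensional ℝ E] [(volume : Measure E).IsAddHaarMeasure]

theorem volume_real_ball_pos {r : ℝ} (hr : 0 < r) : 0 < volume.real (Metric.ball (0 : E) r) :=
  ENNReal.toReal_pos (Metric.measure_ball_pos _ _ hr).ne' measure_ball_lt_top.ne

variable [BorelSpace E]

theorem integrable_ballDensity : Integrable (ballDensity E) :=
  (integrable_indicator_iff measurableSet_ball).2 (integrableOn_const measure_ball_lt_top.ne)

theorem integral_ballDensity : ∫ u, ballDensity E u = 1 := by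
  rw [ballDensity, integral_indicator_const _ measurableSet_ball, smul_eq_mul,
    mul_inv_cancel₀ (volume_real_ball_pos E one_pos).ne']

/-- For ‖a‖ ≥ 1 the trivial bound 2 suffices. Otherwise the ball of radius 1 - ‖a‖ lies in both the
unit ball and its translate, and by Bernoulli the mass outside it is at most d‖a‖, where d is the
dimension; then ‖a‖ ≤ ‖a‖^δ. -/
theorem integral_ballDensity_sub_le [Nontrivial E] {δ : ℝ} (hδ0 : 0 ≤ δ) (hδ1 : δ ≤ 1) (a : E) :
    ∫ u, ‖ballDensity E (u - a) - ballDensity E u‖ ≤ 2 * Module.finrank ℝ E * ‖a‖ ^ δ := by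
  have hd : 1 ≤ (Module.finrank ℝ E : ℝ) := by exact_mod_cast Module.finrank_pos (R := ℝ) (M := E)
  have hρ := integrable_ballDensity E
  rcases le_or_gt 1 ‖a‖ with ha | ha
  · have h1 : ∫ u, ‖ballDensity E (u - a) - ballDensity E u‖ ≤
        ∫ u, (ballDensity E (u - a) + ballDensity E u) := by
      refine integral_mono_of_nonneg (.of_forall fun _ => norm_nonneg _)
        ((hρ.comp_sub_right a).add hρ) (.of_forall fun u => ?_)
      refine (norm_sub_le _ _).trans ?_
      rw [Real.norm_of_nonneg (ballDensity_nonneg E _), Real.norm_of_nonneg (ballDensity_nonneg E _)]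
    rw [integral_add (hρ.comp_sub_right a) hρ, integral_sub_right_eq_self (ballDensity E) a,
      integral_ballDensity] at h1
    have h2 : 1 ≤ ‖a‖ ^ δ := Real.one_le_rpow ha hδ0
    nlinarith
  · set V := volume.real (Metric.ball (0 : E) 1) with hV
    have hV0 : 0 < V := volume_real_ball_pos E one_pos
    set σ : E → ℝ := (Metric.ball (0 : E) (1 - ‖a‖)).indicator fun _ => V⁻¹ with hσ
    have hσi : Integrable σ :=
      (integrable_indicator_iff measurableSet_ball).2 (integrableOn_const measure_ball_lt_top.ne)
    have hσint : ∫ u, σ u = (1 - ‖a‖) ^ Module.finrank ℝ E := by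
      rw [hσ, integral_indicator_const _ measurableSet_ball, smul_eq_mul, measureReal_def,
        Measure.addHaar_ball _ _ (by linarith), ENNReal.toReal_mul,
        ENNReal.toReal_ofReal (pow_nonneg (by linarith) _), ← measureReal_def, ← hV,
        mul_assoc, mul_inv_cancel₀ hV0.ne', mul_one]
    have hsub : ∀ u, σ u ≤ ballDensity E u := fun u =>
      Set.indicator_le_indicator_of_subset (Metric.ball_subset_ball (by linarith [norm_nonneg a]))
        (fun _ => by positivity) u
    have hσle : ∀ u, σ u ≤ ballDensity E (u - a) ∧ σ (u - a) ≤ ballDensity E u := by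
      intro u
      constructor
      · by_cases hu : u ∈ Metric.ball (0 : E) (1 - ‖a‖)
        · have hu2 : u - a ∈ Metric.ball (0 : E) 1 := by
            rw [mem_ball_zero_iff] at hu ⊢
            linarith [norm_sub_le u a]
          rw [hσ, ballDensity, Set.indicator_of_mem hu, Set.indicator_of_mem hu2]
        · rw [hσ, Set.indicator_of_notMem hu]; exact ballDensity_nonneg E _
      · by_cases hu : u - a ∈ Metric.ball (0 : E) (1 - ‖a‖)
        · have hu2 : u ∈ Metric.ball (0 : E) 1 := by
            rw [mem_ball_zero_iff] at hu ⊢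
            have := norm_add_le (u - a) a
            rw [sub_add_cancel] at this
            linarith
          rw [hσ, ballDensity, Set.indicator_of_mem hu, Set.indicator_of_mem hu2]
        · rw [hσ, Set.indicator_of_notMem hu]; exact ballDensity_nonneg E _
    have hpt : ∀ u, ‖ballDensity E (u - a) - ballDensity E u‖ ≤
        (ballDensity E u - σ u) + (ballDensity E (u - a) - σ (u - a)) := by
      intro u
      rw [Real.norm_eq_abs, abs_le]
      constructor <;> linarith [hsub u, hsub (u - a), (hσle u).1, (hσle u).2]
    have hd1 : Integrable fun u => ballDensity E u - σ u := hρ.sub hσi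
    have h1 := integral_mono_of_nonneg (.of_forall fun _ => norm_nonneg _)
      (hd1.add (hd1.comp_sub_right a)) (.of_forall hpt)
    have h2 : ∫ u, ((ballDensity E u - σ u) + (ballDensity E (u - a) - σ (u - a))) =
        2 * (1 - (1 - ‖a‖) ^ Module.finrank ℝ E) := by
      rw [integral_add hd1 (hd1.comp_sub_right a),
        integral_sub_right_eq_self (fun u => ballDensity E u - σ u) a, integral_sub hρ hσi,
        integral_ballDensity, hσint]
      ring
    have h3 := one_add_mul_le_pow (a := -‖a‖) (by linarith) (Module.finrank ℝ E)
    have h4 : ‖a‖ ≤ ‖a‖ ^ δ := by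
      rcases (norm_nonneg a).eq_or_lt with h0 | h0
      · rw [← h0]; positivity
      · nth_rewrite 1 [← Real.rpow_one ‖a‖]
        exact Real.rpow_le_rpow_of_exponent_ge h0 ha.le hδ1
    calc _ ≤ 2 * (1 - (1 - ‖a‖) ^ Module.finrank ℝ E) := h1.trans (le_of_eq h2)
      _ ≤ 2 * Module.finrank ℝ E * ‖a‖ := by rw [← sub_eq_add_neg] at h3; linarith
      _ ≤ _ := by gcongr

end Ball

/-! ### Square function estimate over dyadic scales -/

theorem DecayCondition.integrable_moment {n : ℕ} {A ε δ : ℝ} {ψ : EuclideanSpace ℝ (Fin n) → ℂ}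
    (hψ : DecayCondition A ε ψ) (hm : AEStronglyMeasurable ψ volume) (hA : 0 ≤ A) (hδ0 : 0 ≤ δ)
    (hδ : δ < ε) :
    Integrable (fun u => ‖ψ u‖ * ‖u‖ ^ δ) ∧ ∫ u, ‖ψ u‖ * ‖u‖ ^ δ ≤
      A * ∫ u : EuclideanSpace ℝ (Fin n), (1 + ‖u‖) ^ (-((n : ℝ) + ε - δ)) := by
  have hJ : Integrable fun u : EuclideanSpace ℝ (Fin n) => (1 + ‖u‖) ^ (-((n : ℝ) + ε - δ)) :=
    integrable_one_add_norm (by rw [finrank_euclideanSpace_fin]; linarith)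
  have hpt : ∀ u, ‖ψ u‖ * ‖u‖ ^ δ ≤ A * (1 + ‖u‖) ^ (-((n : ℝ) + ε - δ)) := by
    intro u
    have h1 : (0 : ℝ) < 1 + ‖u‖ := by positivity
    calc ‖ψ u‖ * ‖u‖ ^ δ ≤ (A * (1 + ‖u‖) ^ (-(n : ℝ) - ε)) * (1 + ‖u‖) ^ δ := by
          gcongr
          · exact hψ u
          · linarith
      _ = _ := by rw [mul_assoc, ← Real.rpow_add h1]; congr 2; ring
  refine ⟨(hJ.const_mul A).mono' ?_ (.of_forall fun u => ?_), ?_⟩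
  · exact hm.norm.mul (measurable_norm.pow_const δ).aestronglyMeasurable
  · rw [Real.norm_of_nonneg (by positivity)]; exact hpt u
  · rw [← integral_const_mul]
    exact integral_mono_of_nonneg (.of_forall fun u => by positivity) (hJ.const_mul A)
      (.of_forall hpt)

theorem HolderCondition.integral_sub_le {n : ℕ} {A ε' : ℝ} {ψ : EuclideanSpace ℝ (Fin n) → ℂ}
    (hψ : HolderCondition A ε' ψ) (hA : 0 ≤ A) (a : EuclideanSpace ℝ (Fin n)) :
    ∫ u, ‖ψ (u - a) - ψ u‖ ≤ A * ‖a‖ ^ ε' := by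
  rcases eq_or_ne a 0 with rfl | ha
  · simp only [sub_zero, sub_self, norm_zero, integral_zero]
    positivity
  · simpa [sub_eq_add_neg] using hψ (-a) (neg_ne_zero.2 ha)

theorem half_rpow_pow (η : ℝ) (m : ℕ) : ((1 / 2 : ℝ) ^ m) ^ η = ((1 / 2 : ℝ) ^ η) ^ m := by
  rw [← Real.rpow_natCast, ← Real.rpow_natCast, ← Real.rpow_mul (by norm_num),
    ← Real.rpow_mul (by norm_num), mul_comm]

theorem two_pow_div_rpow_le {η η' : ℝ} (h : η ≤ η') {j k : ℕ} (hkj : k ≤ j) :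
    ((2 : ℝ) ^ k / 2 ^ j) ^ η' ≤ ((1 / 2 : ℝ) ^ η) ^ (j - k) := by
  have h1 : (2 : ℝ) ^ k / 2 ^ j = (1 / 2) ^ (j - k) := by
    rw [one_div, inv_pow, div_eq_iff (by positivity), ← div_eq_inv_mul, eq_div_iff (by positivity),
      ← pow_add]
    congr 1; omega
  rw [h1, half_rpow_pow]
  exact pow_le_pow_left₀ (by positivity)
    (Real.rpow_le_rpow_of_exponent_ge (by norm_num) (by norm_num) h) _

theorem exists_sum_range_norm_avg_sq_le {n : ℕ} (hn : 1 ≤ n) {A ε ε' : ℝ} (hA : 0 < A) (hε : 0 < ε)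
    (hε' : 0 < ε') {c : ℝ} (hc : 0 < c) (X : Type*) [NormedAddCommGroup X] [NormedSpace ℂ X]
    [CompleteSpace X] (hX : TwoUniformlyConvex X c) :
    ∃ C : ℝ, 0 < C ∧ ∀ ψ : EuclideanSpace ℝ (Fin n) → ℂ, IsWavelet ψ → DecayCondition A ε ψ →
      HolderCondition A ε' ψ → ∀ (τ : IsometricRep (EuclideanSpace ℝ (Fin n)) X) (J : ℕ) (x : X),
        ∑ j ∈ Finset.range J, ‖τ.avg ψ (2 ^ j) x‖ ^ 2 ≤ C * ‖x‖ ^ 2 := by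
  have : Nonempty (Fin n) := ⟨⟨0, hn⟩⟩
  set E := EuclideanSpace ℝ (Fin n)
  -- δ < ε makes the δ-moment of ψ finite; δ ≤ 1 because the ball density is only Lipschitz in L¹.
  set δ : ℝ := min 1 (ε / 2) with hδ
  have hδ0 : 0 < δ := lt_min one_pos (by linarith)
  have hδ1 : δ ≤ 1 := min_le_left _ _
  have hδε : δ < ε := (min_le_right _ _).trans_lt (by linarith)
  set η : ℝ := min δ ε' with hη
  have hη0 : 0 < η := lt_min hδ0 hε'
  set I : ℝ := ∫ u : E, (1 + ‖u‖) ^ (-((n : ℝ) + ε - δ)) with hI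
  have hI0 : 0 ≤ I := integral_nonneg fun u => by positivity
  set L : ℝ := 2 * Module.finrank ℝ E with hL
  have hL0 : 0 ≤ L := by positivity
  -- The fine-scale constant A plus the coarse-scale constant L·A·I, so that one `a` serves both;
  -- likewise `η` is the smaller of the two decay exponents.
  set a : ℝ := A + L * (A * I) with ha
  have ha0 : 0 < a := by positivity
  set r : ℝ := (1 / 2) ^ η with hr
  have hr0 : 0 < r := by positivity
  have hr1 : r < 1 := Real.rpow_lt_one (by norm_num) (by norm_num) hη0
  have hr2 : 0 < 1 - r := by linarith
  refine ⟨(4 * a / (r * (1 - r))) ^ 2 * ((2 / (1 - r)) ^ 2 * (3 / (2 * c))), by positivity,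
    fun ψ hψ hdec hhol τ J x => ?_⟩
  have hψi : Integrable ψ := memLp_one_iff_integrable.1 hψ.memLp_one
  set χ : E → ℂ := fun u => (ballDensity E u : ℂ) with hχdef
  have hχ : Integrable χ := (integrable_ballDensity E).ofReal
  have hχ1 : ∫ u, χ u = 1 := by
    rw [hχdef, integral_complex_ofReal, integral_ballDensity, Complex.ofReal_one]
  have hχn : ∫ u, ‖χ u‖ = 1 := by
    rw [← integral_ballDensity E]
    exact integral_congr_ae (.of_forall fun u => by
      simp only [hχdef, Complex.norm_real, Real.norm_of_nonneg (ballDensity_nonneg E u)])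
  have hχmod : ∀ b, ∫ u, ‖χ (u - b) - χ u‖ ≤ L * ‖b‖ ^ δ := fun b => by
    simp only [hχdef, ← Complex.ofReal_sub, Complex.norm_real]
    exact integral_ballDensity_sub_le E hδ0.le hδ1 b
  obtain ⟨hMi, hM⟩ := hdec.integrable_moment hψi.aestronglyMeasurable hA.le hδ0.le hδε
  have h2pos : ∀ j : ℕ, (0 : ℝ) < 2 ^ j := fun j => by positivity
  refine sum_norm_sq_le_of_adapted (R := fun k => τ.avgL hχ (2 ^ k))
    (T := fun j => τ.avgL hψi (2 ^ j)) ha0.le hr0 hr1 (by positivity : 0 < 2 * c) ?_ ?_ ?_ ?_ ?_ J x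
  · intro k x
    exact (τ.norm_avg_le χ (2 ^ k) x).trans (le_of_eq (by rw [hχn, one_mul]))
  · intro i k
    ext y
    exact τ.avg_comm hχ hχ _ _ y
  · intro k x
    exact τ.norm_sub_avg_avg_sq_le hc.le hX (integrable_ballDensity E) (ballDensity_nonneg E)
      (integral_ballDensity E) (ballDensity_neg E) (2 ^ k) x
  · intro j k x hkj
    refine (τ.norm_avg_sub_avg_le hψi hχ hχ1 hχn (fun u hu => ?_) hA.le hε'.le
      (hhol.integral_sub_le hA.le) (h2pos j) (h2pos k) x).trans ?_
    · exact norm_le_one_of_ballDensity_ne_zero E (by simpa [hχdef] using hu)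
    · gcongr
      · rw [ha]; linarith [show 0 ≤ L * (A * I) by positivity]
      · exact two_pow_div_rpow_le (min_le_right _ _) hkj
  · intro j k x hjk
    refine (τ.norm_avg_avg_le hψi hψ.integral_eq_zero hχ hL0 hχmod hMi hM (h2pos j) (h2pos k)
      x).trans ?_
    gcongr
    · rw [ha]; linarith
    · exact two_pow_div_rpow_le (min_le_left _ _) hjk

/-- A finite set of integers lies in some [-K, K], and rescaling the representation by s 2^(-K)
shifts it to nonnegative exponents. Hence the hypothesis for all representations. -/
theorem tsum_int_enorm_avg_sq_le {E X : Type*} [NormedAddCommGroup E] [NormedSpace ℝ E]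
    [MeasureSpace E] [NormedAddCommGroup X] [NormedSpace ℂ X] {ψ : E → ℂ} {C : ℝ} (hC : 0 ≤ C)
    (h : ∀ (τ : IsometricRep E X) (J : ℕ) (x : X),
      ∑ j ∈ Finset.range J, ‖τ.avg ψ (2 ^ j) x‖ ^ 2 ≤ C * ‖x‖ ^ 2)
    (τ : IsometricRep E X) (s : ℝ) (x : X) :
    ∑' j : ℤ, ‖τ.avg ψ (s * 2 ^ j) x‖ₑ ^ 2 ≤ ENNReal.ofReal C * ‖x‖ₑ ^ 2 := by
  rw [ENNReal.tsum_eq_iSup_sum]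
  refine iSup_le fun F => ?_
  set K := F.sup Int.natAbs with hK
  have hsub : F ⊆ (Finset.range (2 * K + 1)).image fun i : ℕ => (i : ℤ) - K := by
    intro j hj
    have hjK : j.natAbs ≤ K := Finset.le_sup (f := Int.natAbs) hj
    exact Finset.mem_image.2 ⟨(j + K).toNat, Finset.mem_range.2 (by omega), by omega⟩
  have key := h (τ.scale (s * 2 ^ (-(K : ℤ)))) (2 * K + 1) x
  calc ∑ j ∈ F, ‖τ.avg ψ (s * 2 ^ j) x‖ₑ ^ 2
      ≤ ∑ j ∈ (Finset.range (2 * K + 1)).image fun i : ℕ => (i : ℤ) - K,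
          ‖τ.avg ψ (s * 2 ^ j) x‖ₑ ^ 2 := Finset.sum_le_sum_of_subset hsub
    _ = ∑ i ∈ Finset.range (2 * K + 1),
          ENNReal.ofReal (‖(τ.scale (s * 2 ^ (-(K : ℤ)))).avg ψ (2 ^ i) x‖ ^ 2) := by
        rw [Finset.sum_image fun a _ b _ hab => by simpa using hab]
        refine Finset.sum_congr rfl fun i _ => ?_
        rw [IsometricRep.avg_scale, ENNReal.ofReal_pow (norm_nonneg _), ofReal_norm, mul_assoc,
          ← zpow_natCast (2 : ℝ) i, ← zpow_add₀ (two_ne_zero), sub_eq_neg_add]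
    _ = ENNReal.ofReal (∑ i ∈ Finset.range (2 * K + 1),
          ‖(τ.scale (s * 2 ^ (-(K : ℤ)))).avg ψ (2 ^ i) x‖ ^ 2) :=
        (ENNReal.ofReal_sum_of_nonneg fun _ _ => by positivity).symm
    _ ≤ ENNReal.ofReal (C * ‖x‖ ^ 2) := ENNReal.ofReal_le_ofReal key
    _ = _ := by rw [ENNReal.ofReal_mul hC, ENNReal.ofReal_pow (norm_nonneg _), ofReal_norm]

/-- From dyadic scales to the measure `dt/t`. -/
theorem lintegral_Ioi_div_le_of_tsum_le {F : ℝ → ℝ≥0∞} (hF : Measurable F) {B : ℝ≥0∞}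
    (h : ∀ s, ∑' j : ℤ, F (s * 2 ^ j) ≤ B) :
    ∫⁻ t in Set.Ioi (0 : ℝ), F t * ENNReal.ofReal (1 / t) ≤ B := by
  have hcov : Set.Ioi (0 : ℝ) ⊆ ⋃ j : ℤ, Set.Ico ((2 : ℝ) ^ j) (2 ^ (j + 1)) := by
    intro t ht
    obtain ⟨j, hj⟩ := exists_mem_Ico_zpow (x := t) (y := (2 : ℝ)) ht one_lt_two
    exact Set.mem_iUnion.2 ⟨j, hj⟩
  -- Invariance of dt/t under dilation by 2^j brings every dyadic interval back to [1, 2).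
  have hpiece : ∀ j : ℤ, ∫⁻ t in Set.Ico ((2 : ℝ) ^ j) (2 ^ (j + 1)), F t * ENNReal.ofReal (1 / t) =
      ∫⁻ s in Set.Ico (1 : ℝ) 2, F (s * 2 ^ j) * ENNReal.ofReal (1 / s) := by
    intro j
    have h2 : (0 : ℝ) < 2 ^ j := by positivity
    have himg : (fun s : ℝ => s * 2 ^ j) '' Set.Ico (1 : ℝ) 2 = Set.Ico ((2 : ℝ) ^ j) (2 ^ (j + 1)) := by
      rw [Set.image_mul_right_Ico _ _ h2, one_mul, zpow_add₀ two_ne_zero, zpow_one, mul_comm]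
    rw [← himg, lintegral_image_eq_lintegral_abs_deriv_mul measurableSet_Ico
      (f' := fun _ => 2 ^ j) (fun s _ => by
        simpa using ((hasDerivAt_id s).mul_const ((2 : ℝ) ^ j)).hasDerivWithinAt)
      (fun a _ b _ hab => mul_right_cancel₀ h2.ne' hab)]
    refine setLIntegral_congr_fun measurableSet_Ico fun s hs => ?_
    have hs0 : 0 < s := by linarith [hs.1]
    rw [mul_left_comm, ← ENNReal.ofReal_mul (abs_nonneg _), abs_of_pos h2]
    congr 2
    field_simp
  calc ∫⁻ t in Set.Ioi (0 : ℝ), F t * ENNReal.ofReal (1 / t)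
      ≤ ∫⁻ t in ⋃ j : ℤ, Set.Ico ((2 : ℝ) ^ j) (2 ^ (j + 1)), F t * ENNReal.ofReal (1 / t) :=
        lintegral_mono_set hcov
    _ ≤ ∑' j : ℤ, ∫⁻ t in Set.Ico ((2 : ℝ) ^ j) (2 ^ (j + 1)), F t * ENNReal.ofReal (1 / t) :=
        lintegral_iUnion_le _ _
    _ = ∫⁻ s in Set.Ico (1 : ℝ) 2, ∑' j : ℤ, F (s * 2 ^ j) * ENNReal.ofReal (1 / s) := by
        simp_rw [hpiece]
        refine (lintegral_tsum fun j => ?_).symm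
        exact ((hF.comp (measurable_id.mul_const _)).mul (by fun_prop)).aemeasurable
    _ ≤ ∫⁻ s in Set.Ico (1 : ℝ) 2, B := by
        refine setLIntegral_mono measurable_const fun s hs => ?_
        rw [ENNReal.tsum_mul_right]
        refine (mul_le_mul' (h s) (?_ : ENNReal.ofReal (1 / s) ≤ 1)).trans (mul_one B).le
        rw [ENNReal.ofReal_le_one, div_le_one (by linarith [hs.1])]
        exact hs.1
    _ = B := by
        rw [setLIntegral_const, Real.volume_Ico]; norm_num

/-! ### Translations of `L^q` and convolutions -/

theorem integrableOn_Lp {α : Type*} [MeasurableSpace α] {μ : Measure α} {q : ℝ≥0∞} (hq : 1 ≤ q)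
    {s : Set α} (hs : μ s ≠ ∞) (f : Lp ℂ q μ) : IntegrableOn f s μ := by
  have : IsFiniteMeasure (μ.restrict s) := ⟨by rw [Measure.restrict_apply_univ]; exact hs.lt_top⟩
  exact ((Lp.memLp f).restrict s).integrable hq

theorem setIntegral_norm_Lp_le {α : Type*} [MeasurableSpace α] {μ : Measure α} {q : ℝ≥0∞}
    (hq : 1 ≤ q) {s : Set α} (hs : μ s ≠ ∞) (f : Lp ℂ q μ) :
    ∫ x in s, ‖f x‖ ∂μ ≤ (μ s ^ (1 - 1 / q.toReal)).toReal * ‖f‖ := by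
  have hexp : 0 ≤ 1 - 1 / q.toReal := by
    rcases eq_or_ne q ∞ with rfl | hq'
    · simp
    · have : 1 ≤ q.toReal := by simpa using ENNReal.toReal_mono hq' hq
      rw [sub_nonneg, div_le_one (by linarith)]; exact this
  have hm : AEStronglyMeasurable f (μ.restrict s) := (Lp.aestronglyMeasurable f).restrict
  have h1 := eLpNorm_le_eLpNorm_mul_rpow_measure_univ hq hm
  rw [Measure.restrict_apply_univ, ENNReal.toReal_one, div_one] at h1
  have h2 : eLpNorm f 1 (μ.restrict s) ≤ μ s ^ (1 - 1 / q.toReal) * eLpNorm f q μ := by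
    rw [mul_comm]
    exact h1.trans (mul_le_mul_left (eLpNorm_mono_measure _ Measure.restrict_le_self) _)
  have h3 := ENNReal.toReal_mono (ENNReal.mul_ne_top (ENNReal.rpow_ne_top_of_nonneg hexp hs)
    (Lp.eLpNorm_ne_top f)) h2
  rw [ENNReal.toReal_mul, ← Lp.norm_def] at h3
  rw [integral_norm_eq_lintegral_enorm hm, ← eLpNorm_one_eq_lintegral_enorm]
  exact h3

/-- Integration over a set of finite measure, as a functional on `L^q`. -/
noncomputable def setIntegralL {α : Type*} [MeasurableSpace α] {μ : Measure α} (q : ℝ≥0∞)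
    [hq : Fact (1 ≤ q)] {s : Set α} (hs : μ s ≠ ∞) : Lp ℂ q μ →L[ℂ] ℂ :=
  LinearMap.mkContinuous
    { toFun := fun f => ∫ x in s, f x ∂μ
      map_add' := fun f g => by
        rw [← integral_add (integrableOn_Lp hq.out hs f) (integrableOn_Lp hq.out hs g)]
        exact integral_congr_ae (ae_restrict_of_ae (Lp.coeFn_add f g))
      map_smul' := fun c f => by
        rw [RingHom.id_apply, ← integral_smul]
        exact integral_congr_ae (ae_restrict_of_ae (Lp.coeFn_smul c f)) }
    (μ s ^ (1 - 1 / q.toReal)).toReal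
    (fun f => (norm_integral_le_integral_norm _).trans (setIntegral_norm_Lp_le hq.out hs f))

theorem setIntegralL_apply {α : Type*} [MeasurableSpace α] {μ : Measure α} (q : ℝ≥0∞)
    [Fact (1 ≤ q)] {s : Set α} (hs : μ s ≠ ∞) (f : Lp ℂ q μ) :
    setIntegralL q hs f = ∫ x in s, f x ∂μ := rfl

section Translation

variable {n : ℕ} (q : ℝ≥0∞) [hq1 : Fact (1 ≤ q)]

/-- The translation `f ↦ f(· - a)` of `L^q(ℝⁿ)`. -/
noncomputable def translate (a : EuclideanSpace ℝ (Fin n)) :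
    Lp ℂ q (volume : Measure (EuclideanSpace ℝ (Fin n))) →ₗᵢ[ℂ]
      Lp ℂ q (volume : Measure (EuclideanSpace ℝ (Fin n))) :=
  Lp.compMeasurePreservingₗᵢ ℂ (fun x => x - a) (measurePreserving_sub_right volume a)

theorem translate_ae_eq (a : EuclideanSpace ℝ (Fin n))
    (f : Lp ℂ q (volume : Measure (EuclideanSpace ℝ (Fin n)))) :
    translate q a f =ᵐ[volume] fun x => f (x - a) :=
  Lp.coeFn_compMeasurePreserving f (measurePreserving_sub_right volume a)

/-- On a set of finite measure L^q embeds in L¹, with a bound uniform over translates; this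
justifies Fubini below. -/
theorem integrable_prod_translate {g : EuclideanSpace ℝ (Fin n) → ℂ} (hg : Integrable g)
    (f : Lp ℂ q (volume : Measure (EuclideanSpace ℝ (Fin n))))
    {s : Set (EuclideanSpace ℝ (Fin n))} (hs : volume s ≠ ∞) :
    Integrable (fun z : EuclideanSpace ℝ (Fin n) × EuclideanSpace ℝ (Fin n) =>
      f (z.1 - z.2) * g z.2) ((volume.restrict s).prod volume) := by
  have hfm : StronglyMeasurable fun z : EuclideanSpace ℝ (Fin n) × EuclideanSpace ℝ (Fin n) =>
      f (z.1 - z.2) :=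
    (Lp.stronglyMeasurable f).comp_measurable (measurable_fst.sub measurable_snd)
  have hae : ∀ u, (fun x => f (x - u)) =ᵐ[volume.restrict s] translate q u f := fun u =>
    ae_restrict_of_ae (translate_ae_eq q u f).symm
  have hm : AEStronglyMeasurable (fun z : EuclideanSpace ℝ (Fin n) × EuclideanSpace ℝ (Fin n) =>
      f (z.1 - z.2) * g z.2) ((volume.restrict s).prod volume) :=
    hfm.aestronglyMeasurable.mul hg.aestronglyMeasurable.comp_snd
  refine (integrable_prod_iff' hm).2 ⟨.of_forall fun u => ?_, ?_⟩
  · exact ((integrableOn_Lp hq1.out hs (translate q u f)).congr (hae u).symm).mul_const (g u)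
  · refine Integrable.mono' (hg.norm.const_mul ((volume s ^ (1 - 1 / q.toReal)).toReal * ‖f‖)) ?_
      (.of_forall fun u => ?_)
    · exact hm.norm.prod_swap.integral_prod_right'
    · rw [Real.norm_of_nonneg (integral_nonneg fun _ => norm_nonneg _)]
      simp_rw [norm_mul, integral_mul_const]
      refine mul_le_mul_of_nonneg_right ?_ (norm_nonneg _)
      have h := setIntegral_norm_Lp_le hq1.out hs (translate q u f)
      rw [LinearIsometry.norm_map] at h
      refine le_trans (le_of_eq (integral_congr_ae ?_)) h
      filter_upwards [hae u] with x hx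
      rw [hx]

theorem convolution_eq_integral (f g : EuclideanSpace ℝ (Fin n) → ℂ)
    (x : EuclideanSpace ℝ (Fin n)) :
    (f ⋆[ContinuousLinearMap.mul ℝ ℂ, volume] g) x = ∫ u, f (x - u) * g u := by
  rw [convolution_def, ← integral_sub_left_eq_self _ volume x]
  simp

variable [hqtop : Fact (q ≠ ∞)]

theorem continuous_translate (f : Lp ℂ q (volume : Measure (EuclideanSpace ℝ (Fin n)))) :
    Continuous fun a => translate q a f :=
  Continuous.compMeasurePreservingLp (f := fun _ : EuclideanSpace ℝ (Fin n) => f)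
    (g := fun a => (⟨fun x => x - a, by fun_prop⟩ : C(EuclideanSpace ℝ (Fin n), _)))
    continuous_const
    (ContinuousMap.curry ⟨fun z : EuclideanSpace ℝ (Fin n) × EuclideanSpace ℝ (Fin n) => z.2 - z.1,
      by fun_prop⟩).continuous
    (fun a => measurePreserving_sub_right volume a) hqtop.out

/-- The isometric representation of `ℝⁿ` on `L^q(ℝⁿ)` by translations. -/
noncomputable def translationRep : IsometricRep (EuclideanSpace ℝ (Fin n))
    (Lp ℂ q (volume : Measure (EuclideanSpace ℝ (Fin n)))) where
  toFun a := (translate q a).toContinuousLinearMap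
  map_zero' f := by
    refine Lp.ext ((translate_ae_eq q 0 f).trans (.of_forall fun x => ?_))
    simp only [sub_zero]
  map_add' a b f := by
    refine Lp.ext ((translate_ae_eq q (a + b) f).trans ?_)
    refine .trans ?_ (translate_ae_eq q a (translate q b f)).symm
    have h := (measurePreserving_sub_right volume a).quasiMeasurePreserving.ae_eq_comp
      (translate_ae_eq q b f)
    filter_upwards [h] with x hx
    simp only [Function.comp_apply] at hx
    rw [hx, sub_sub]
  norm_map' a f := (translate q a).norm_map f
  continuous' f := continuous_translate q f

/-- A Bochner integral in L^q has no pointwise formula, so the two sides are compared through their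
integrals over sets of finite measure: these functionals pass under the Bochner integral, and Fubini
does the rest. -/
theorem avg_ae_eq_convolution {g : EuclideanSpace ℝ (Fin n) → ℂ} (hg : Integrable g)
    (f : Lp ℂ q (volume : Measure (EuclideanSpace ℝ (Fin n)))) :
    (translationRep q).avg g 1 f =ᵐ[volume] (f ⋆[ContinuousLinearMap.mul ℝ ℂ, volume] g) := by
  refine ae_eq_of_forall_setIntegral_eq_of_sigmaFinite
    (fun s _ hs => integrableOn_Lp hq1.out hs.ne _) (fun s _ hs => ?_) (fun s _ hs => ?_)
  · have := (integrable_prod_translate q hg f hs.ne).integral_prod_left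
    simp only [← convolution_eq_integral] at this
    exact this
  · rw [← setIntegralL_apply q hs.ne, IsometricRep.avg_comp_clm _ hg]
    simp only [convolution_eq_integral, one_smul]
    rw [integral_integral_swap (integrable_prod_translate q hg f hs.ne)]
    refine integral_congr_ae (.of_forall fun u => ?_)
    simp only [setIntegralL_apply, smul_eq_mul]
    rw [integral_mul_const, mul_comm]
    congr 1
    exact integral_congr_ae (ae_restrict_of_ae (translate_ae_eq q u f))

end Translation

theorem convolution_congr_left_ae {n : ℕ} {f f' : EuclideanSpace ℝ (Fin n) → ℂ}
    (h : f =ᵐ[volume] f') (g : EuclideanSpace ℝ (Fin n) → ℂ) :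
    (f ⋆[ContinuousLinearMap.mul ℝ ℂ, volume] g) =
      (f' ⋆[ContinuousLinearMap.mul ℝ ℂ, volume] g) := by
  ext x
  rw [convolution_def, convolution_def]
  refine integral_congr_ae ?_
  filter_upwards [h] with t ht
  rw [ht]

theorem IsometricRep.avg_const_mul_comp_inv_smul {n : ℕ} {X : Type*} [NormedAddCommGroup X]
    [NormedSpace ℂ X] (τ : IsometricRep (EuclideanSpace ℝ (Fin n)) X)
    (ψ : EuclideanSpace ℝ (Fin n) → ℂ) (k : ℝ) {s : ℝ} (hs : 0 < s) (x : X) :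
    τ.avg (fun u => k • ψ (s⁻¹ • u)) 1 x = (k * s ^ n) • τ.avg ψ s x := by
  have h := Measure.integral_comp_smul_of_nonneg volume
    (fun v => k • (ψ v • τ.toFun (s • v) x)) s⁻¹ (hR := by positivity)
  rw [finrank_euclideanSpace_fin, inv_pow, inv_inv, integral_smul k] at h
  rw [mul_comm, mul_smul, avg, avg, ← integral_smul k, ← h, ← integral_smul k]
  refine integral_congr_ae (.of_forall fun u => ?_)
  simp only [smul_smul, mul_inv_cancel₀ hs.ne', smul_assoc]

/-! ### The modulus on `L^q` -/

theorem lipschitzWith_ofReal_norm : LipschitzWith 1 fun z : ℂ => ((‖z‖ : ℝ) : ℂ) :=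
  LipschitzWith.of_dist_le_mul fun z w => by
    rw [dist_eq_norm, dist_eq_norm, ← Complex.ofReal_sub, Complex.norm_real, NNReal.coe_one,
      one_mul]
    exact abs_norm_sub_norm_le z w

/-- The modulus `f ↦ |f|` on `L^q`. -/
noncomputable def modulus {α : Type*} [MeasurableSpace α] {μ : Measure α} {q : ℝ≥0∞}
    (f : Lp ℂ q μ) : Lp ℂ q μ :=
  lipschitzWith_ofReal_norm.compLp (by simp) f

theorem modulus_ae_eq {α : Type*} [MeasurableSpace α] {μ : Measure α} {q : ℝ≥0∞}
    (f : Lp ℂ q μ) : modulus f =ᵐ[μ] fun x => ((‖f x‖ : ℝ) : ℂ) :=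
  lipschitzWith_ofReal_norm.coeFn_compLp (by simp) f

theorem norm_modulus {α : Type*} [MeasurableSpace α] {μ : Measure α} {q : ℝ≥0∞}
    (f : Lp ℂ q μ) : ‖modulus f‖ = ‖f‖ := by
  rw [Lp.norm_def, Lp.norm_def]
  congr 1
  refine eLpNorm_congr_norm_ae ?_
  filter_upwards [modulus_ae_eq f] with x hx
  rw [hx, Complex.norm_real, norm_norm]

theorem continuous_modulus {α : Type*} [MeasurableSpace α] {μ : Measure α} {q : ℝ≥0∞}
    [Fact (1 ≤ q)] : Continuous (modulus : Lp ℂ q μ → Lp ℂ q μ) :=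
  lipschitzWith_ofReal_norm.continuous_compLp (by simp)

/-! ### Cascades in a Banach space -/

/-- The cascade of operators `V s` and a nonlinearity `N` between consecutive layers. -/
def opCascade {S X : Type*} (V : S → X → X) (N : X → X) : (m : ℕ) → (Fin m → S) → X → X
  | 0, _, x => x
  | 1, t, x => V (t 0) x
  | m + 2, t, x => V (t (Fin.last (m + 1))) (N (opCascade V N (m + 1) (Fin.init t) x))

theorem continuous_opCascade {S X : Type*} [TopologicalSpace S] [TopologicalSpace X]
    {V : S → X → X} {N : X → X} (hV : Continuous fun z : S × X => V z.1 z.2) (hN : Continuous N)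
    (m : ℕ) (x : X) : Continuous fun t : Fin m → S => opCascade V N m t x := by
  induction m using Nat.twoStepInduction with
  | zero => exact continuous_const
  | one =>
    exact hV.comp (f := fun t : Fin 1 → S => (t 0, x)) ((continuous_apply 0).prodMk continuous_const)
  | more m _ ih =>
    have hinit : Continuous fun t : Fin (m + 2) → S => (Fin.init t : Fin (m + 1) → S) :=
      continuous_pi fun i => continuous_apply i.castSucc
    exact hV.comp (f := fun t : Fin (m + 2) → S =>
      (t (Fin.last (m + 1)), N (opCascade V N (m + 1) (Fin.init t) x)))
      ((continuous_apply _).prodMk (hN.comp (ih.comp hinit)))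

/-- Tonelli, integrating the last scale first: each layer costs a factor `B`, and the nonlinearity
costs nothing. Linearity plays no role. -/
theorem lintegral_opCascade_le {S X : Type*} [TopologicalSpace S] [SecondCountableTopology S]
    [MeasurableSpace S] [BorelSpace S] {ν : Measure S} [SigmaFinite ν] [NormedAddCommGroup X]
    {V : S → X → X} {N : X → X} (hV : Continuous fun z : S × X => V z.1 z.2) (hN : Continuous N)
    (hNn : ∀ x, ‖N x‖ = ‖x‖) {B : ℝ≥0∞} (hB : ∀ x, ∫⁻ s, ‖V s x‖ₑ ^ 2 ∂ν ≤ B * ‖x‖ₑ ^ 2)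
    (m : ℕ) (x : X) :
    ∫⁻ t, ‖opCascade V N (m + 1) t x‖ₑ ^ 2 ∂(Measure.pi fun _ : Fin (m + 1) => ν) ≤
      B ^ (m + 1) * ‖x‖ₑ ^ 2 := by
  have hmeas : ∀ m, Measurable fun t : Fin m → S => ‖opCascade V N m t x‖ₑ ^ 2 := fun m =>
    (continuous_opCascade hV hN m x).enorm.measurable.pow_const 2
  induction m with
  | zero =>
    have hmp := measurePreserving_funUnique ν (Fin 1)
    have h := hmp.lintegral_comp (f := fun s => ‖V s x‖ₑ ^ 2)
      ((hV.comp (f := fun s => (s, x))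
        (continuous_id.prodMk continuous_const)).enorm.measurable.pow_const 2)
    rw [zero_add, pow_one]
    exact h.le.trans (hB x)
  | succ m ih =>
    have hmp := measurePreserving_piFinSuccAbove (fun _ : Fin (m + 2) => ν) (Fin.last (m + 1))
    set G : S × (Fin (m + 1) → S) → ℝ≥0∞ := fun z =>
      ‖V z.1 (N (opCascade V N (m + 1) z.2 x))‖ₑ ^ 2 with hG
    have hGm : Measurable G :=
      (hV.comp (f := fun z : S × (Fin (m + 1) → S) => (z.1, N (opCascade V N (m + 1) z.2 x)))
        (continuous_fst.prodMk (hN.comp ((continuous_opCascade hV hN (m + 1) x).comp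
          continuous_snd)))).enorm.measurable.pow_const 2
    have h := hmp.lintegral_comp hGm
    have hcomp : ∀ t : Fin (m + 2) → S,
        G (MeasurableEquiv.piFinSuccAbove (fun _ => S) (Fin.last (m + 1)) t) =
          ‖opCascade V N (m + 2) t x‖ₑ ^ 2 := by
      intro t
      have h1 : (MeasurableEquiv.piFinSuccAbove (fun _ => S) (Fin.last (m + 1)) t).2 =
          Fin.init t := by
        ext i
        simp [MeasurableEquiv.piFinSuccAbove, Fin.init]
      rw [hG]
      simp only [h1]
      rfl
    simp only [hcomp] at h
    rw [h, lintegral_prod_symm _ hGm.aemeasurable]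
    calc ∫⁻ y, ∫⁻ s, G (s, y) ∂ν ∂(Measure.pi fun _ : Fin (m + 1) => ν)
        ≤ ∫⁻ y, B * ‖opCascade V N (m + 1) y x‖ₑ ^ 2 ∂(Measure.pi fun _ : Fin (m + 1) => ν) := by
          refine lintegral_mono fun y => (hB (N (opCascade V N (m + 1) y x))).trans (le_of_eq ?_)
          rw [enorm_eq_iff_norm_eq.2 (hNn _)]
      _ = B * ∫⁻ y, ‖opCascade V N (m + 1) y x‖ₑ ^ 2 ∂(Measure.pi fun _ : Fin (m + 1) => ν) :=
          lintegral_const_mul _ (hmeas _)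
      _ ≤ B * (B ^ (m + 1) * ‖x‖ₑ ^ 2) := by gcongr
      _ = B ^ (m + 1 + 1) * ‖x‖ₑ ^ 2 := by ring

/-- The cascade of functions represents the cascade in `L^q`. -/
theorem cascade_ae_eq {n : ℕ} {q : ℝ≥0∞} {S : Type*}
    {V : S → Lp ℂ q (volume : Measure (EuclideanSpace ℝ (Fin n))) → Lp ℂ q volume}
    {g : S → EuclideanSpace ℝ (Fin n) → ℂ} {P : S → Prop}
    (hV : ∀ s, P s → ∀ h : Lp ℂ q (volume : Measure (EuclideanSpace ℝ (Fin n))),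
      V s h =ᵐ[volume] (h ⋆[ContinuousLinearMap.mul ℝ ℂ, volume] g s))
    {f : EuclideanSpace ℝ (Fin n) → ℂ} (hf : MemLp f q volume) (m : ℕ) (t : Fin m → S)
    (ht : ∀ i, P (t i)) :
    (opCascade V modulus m t (hf.toLp f) : Lp ℂ q volume) =ᵐ[volume] cascade m (fun i => g (t i)) f := by
  induction m using Nat.twoStepInduction with
  | zero => exact hf.coeFn_toLp
  | one =>
    refine (hV (t 0) (ht 0) _).trans (.of_eq ?_)
    exact convolution_congr_left_ae hf.coeFn_toLp _
  | more m _ ih =>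
    refine (hV _ (ht _) _).trans (.of_eq ?_)
    refine convolution_congr_left_ae ((modulus_ae_eq _).trans ?_) _
    filter_upwards [ih (Fin.init t) fun i => ht _] with x hx
    rw [hx]
    rfl

/-! ### The layers of the scattering transforms -/

/-- The point is ‖Z‖^(qp) = ‖Z‖². Equality is asked only almost everywhere because the continuous
layers are identified with convolutions only at positive scales. -/
theorem memLp_and_lpNorm_le_of_ae_eq {T X : Type*} [MeasurableSpace T] {ν : Measure T}
    [NormedAddCommGroup X] {Z : T → X} (hZ : AEStronglyMeasurable (fun t => ‖Z t‖) ν) {S : T → ℝ}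
    {p q : ℝ} (hq : 0 < q) (hp : 0 < p) (hpq : q * p = 2) (hS : S =ᵐ[ν] fun t => ‖Z t‖ ^ q)
    {D : ℝ} (hD : 0 ≤ D) (x : X) (h : ∫⁻ t, ‖Z t‖ₑ ^ 2 ∂ν ≤ ENNReal.ofReal D * ‖x‖ₑ ^ 2) :
    MemLp S (ENNReal.ofReal p) ν ∧ lpNorm S (ENNReal.ofReal p) ν ≤ D ^ (1 / p) * ‖x‖ ^ q := by
  have hSm : AEStronglyMeasurable S ν :=
    (hZ.aemeasurable.pow_const q).aestronglyMeasurable.congr hS.symm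
  have h0 : ENNReal.ofReal p ≠ 0 := by simpa using hp
  have hpow : ∀ y : X, (‖y‖ₑ ^ q) ^ p = ‖y‖ₑ ^ 2 := fun y => by
    rw [← ENNReal.rpow_mul, hpq, ENNReal.rpow_ofNat]
  have hle : eLpNorm S (ENNReal.ofReal p) ν ≤ ENNReal.ofReal (D ^ (1 / p) * ‖x‖ ^ q) := by
    rw [eLpNorm_eq_lintegral_rpow_enorm_toReal h0 ENNReal.ofReal_ne_top,
      ENNReal.toReal_ofReal hp.le]
    have h1 : ∫⁻ t, ‖S t‖ₑ ^ p ∂ν = ∫⁻ t, ‖Z t‖ₑ ^ 2 ∂ν := by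
      refine lintegral_congr_ae ?_
      filter_upwards [hS] with t ht
      rw [ht, ← hpow, Real.enorm_eq_ofReal (by positivity),
        ← ENNReal.ofReal_rpow_of_nonneg (norm_nonneg _) hq.le, ofReal_norm]
    rw [h1]
    refine (ENNReal.rpow_le_rpow h (by positivity)).trans (le_of_eq ?_)
    rw [ENNReal.mul_rpow_of_nonneg _ _ (by positivity), ← hpow, ← ENNReal.rpow_mul (_ ^ q),
      mul_one_div_cancel hp.ne', ENNReal.rpow_one,
      ENNReal.ofReal_rpow_of_nonneg hD (by positivity), ENNReal.ofReal_mul (by positivity),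
      ← ENNReal.ofReal_rpow_of_nonneg (norm_nonneg _) hq.le, ofReal_norm]
  refine ⟨⟨hSm, hle.trans_lt ENNReal.ofReal_lt_top⟩, ?_⟩
  rw [← toReal_eLpNorm hSm]
  exact ENNReal.toReal_le_of_le_ofReal (by positivity) hle

theorem summable_and_tsum_le_of_lintegral_count_le {T X : Type*} [MeasurableSpace T]
    [MeasurableSingletonClass T] [NormedAddCommGroup X] {Z : T → X} {S : T → ℝ}
    {p q : ℝ} (hp : 0 < p) (hpq : q * p = 2) (hS : ∀ t, S t = ‖Z t‖ ^ q)
    {D : ℝ} (hD : 0 ≤ D) (x : X)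
    (h : ∫⁻ t, ‖Z t‖ₑ ^ 2 ∂Measure.count ≤ ENNReal.ofReal D * ‖x‖ₑ ^ 2) :
    Summable (fun t => |S t| ^ p) ∧ (∑' t, |S t| ^ p) ^ (1 / p) ≤ D ^ (1 / p) * ‖x‖ ^ q := by
  have hpow : ∀ y : X, (‖y‖ ^ q) ^ p = ‖y‖ ^ 2 := fun y => by
    rw [← Real.rpow_mul (norm_nonneg _), hpq, Real.rpow_ofNat]
  have hterm : ∀ t, |S t| ^ p = ‖Z t‖ ^ 2 := fun t => by
    rw [hS, abs_of_nonneg (by positivity), hpow]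
  rw [lintegral_count] at h
  have hsum : ∀ F : Finset T, ∑ t ∈ F, ‖Z t‖ ^ 2 ≤ D * ‖x‖ ^ 2 := fun F => by
    rw [← ENNReal.ofReal_le_ofReal_iff (by positivity),
      ENNReal.ofReal_sum_of_nonneg fun _ _ => by positivity, ENNReal.ofReal_mul hD]
    simp only [ENNReal.ofReal_pow (norm_nonneg _), ofReal_norm]
    exact (ENNReal.sum_le_tsum F).trans h
  simp only [hterm]
  refine ⟨summable_of_sum_le (fun _ => by positivity) hsum, ?_⟩
  calc (∑' t, ‖Z t‖ ^ 2) ^ (1 / p) ≤ (D * ‖x‖ ^ 2) ^ (1 / p) :=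
        Real.rpow_le_rpow (tsum_nonneg fun _ => by positivity)
          (Real.tsum_le_of_sum_le (fun _ => by positivity) hsum) (by positivity)
    _ = _ := by
        rw [Real.mul_rpow hD (by positivity), ← hpow, ← Real.rpow_mul (by positivity),
          mul_one_div_cancel hp.ne', Real.rpow_one]

section Layers

variable {n : ℕ} {X : Type*} [NormedAddCommGroup X] [NormedSpace ℂ X]

/-- One layer of the continuous transform, `x ↦ x ∗ ψ_s` with the `L²`-normalized dilation. -/
noncomputable def contLayer (τ : IsometricRep (EuclideanSpace ℝ (Fin n)) X)
    (ψ : EuclideanSpace ℝ (Fin n) → ℂ) (s : ℝ) (x : X) : X :=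
  s ^ ((n : ℝ) / 2) • τ.avg ψ s x

/-- As n/2 ≥ 0, the factor is continuous on all of ℝ. Measurability of the transform thus follows
from continuity, without removing the scales s ≤ 0, which `scaleMeasure` does not charge. -/
theorem continuous_contLayer (τ : IsometricRep (EuclideanSpace ℝ (Fin n)) X)
    {ψ : EuclideanSpace ℝ (Fin n) → ℂ} (hψ : Integrable ψ) :
    Continuous fun z : ℝ × X => contLayer τ ψ z.1 z.2 :=
  ((Real.continuous_rpow_const (by positivity)).comp continuous_fst).smul (τ.continuous_avg hψ)

/-- One layer of the dyadic transform. -/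
noncomputable def dyadLayer (τ : IsometricRep (EuclideanSpace ℝ (Fin n)) X)
    (ψ : EuclideanSpace ℝ (Fin n) → ℂ) (j : ℤ) (x : X) : X :=
  τ.avg ψ (2 ^ j) x

theorem continuous_dyadLayer (τ : IsometricRep (EuclideanSpace ℝ (Fin n)) X)
    {ψ : EuclideanSpace ℝ (Fin n) → ℂ} (hψ : Integrable ψ) :
    Continuous fun z : ℤ × X => dyadLayer τ ψ z.1 z.2 :=
  (τ.continuous_avg hψ).comp (f := fun z : ℤ × X => ((2 : ℝ) ^ z.1, z.2))
    ((continuous_of_discreteTopology.comp continuous_fst).prodMk continuous_snd)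

theorem integrable_dilate {ψ : EuclideanSpace ℝ (Fin n) → ℂ} (hψ : Integrable ψ) {s : ℝ}
    (hs : 0 < s) : Integrable (dilate ψ s) :=
  (hψ.comp_smul (inv_ne_zero hs.ne')).smul (s ^ (-(n : ℝ) / 2))

theorem integrable_dyadicDilate {ψ : EuclideanSpace ℝ (Fin n) → ℂ} (hψ : Integrable ψ) (j : ℤ) :
    Integrable (dyadicDilate ψ j) :=
  (hψ.comp_smul (zpow_ne_zero (-j) two_ne_zero)).smul ((2 : ℝ) ^ (-((n : ℤ) * j)))

theorem avg_dilate (τ : IsometricRep (EuclideanSpace ℝ (Fin n)) X)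
    (ψ : EuclideanSpace ℝ (Fin n) → ℂ) {s : ℝ} (hs : 0 < s) (x : X) :
    τ.avg (dilate ψ s) 1 x = contLayer τ ψ s x := by
  have h := τ.avg_const_mul_comp_inv_smul ψ (s ^ (-(n : ℝ) / 2)) hs x
  rw [← Real.rpow_natCast, ← Real.rpow_add hs, show -(n : ℝ) / 2 + n = n / 2 by ring] at h
  exact h

theorem avg_dyadicDilate (τ : IsometricRep (EuclideanSpace ℝ (Fin n)) X)
    (ψ : EuclideanSpace ℝ (Fin n) → ℂ) (j : ℤ) (x : X) :
    τ.avg (dyadicDilate ψ j) 1 x = dyadLayer τ ψ j x := by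
  have h2 : (0 : ℝ) < 2 ^ j := by positivity
  have h := τ.avg_const_mul_comp_inv_smul ψ (2 ^ (-((n : ℤ) * j))) h2 x
  rw [← zpow_neg, ← zpow_natCast ((2 : ℝ) ^ j), ← zpow_mul, ← zpow_add₀ two_ne_zero, mul_comm j,
    neg_add_cancel, zpow_zero, one_smul] at h
  exact h

theorem lintegral_contLayer_le (τ : IsometricRep (EuclideanSpace ℝ (Fin n)) X)
    {ψ : EuclideanSpace ℝ (Fin n) → ℂ} (hψ : Integrable ψ) {B : ℝ≥0∞} {x : X}
    (h : ∀ s, ∑' j : ℤ, ‖τ.avg ψ (s * 2 ^ j) x‖ₑ ^ 2 ≤ B) :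
    ∫⁻ s, ‖contLayer τ ψ s x‖ₑ ^ 2 ∂scaleMeasure n ≤ B := by
  have hV : Measurable fun s : ℝ => ‖contLayer τ ψ s x‖ₑ ^ 2 :=
    ((continuous_contLayer τ hψ).comp (f := fun s : ℝ => (s, x))
      (continuous_id.prodMk continuous_const)).enorm.measurable.pow_const 2
  have hF : Measurable fun s : ℝ => ‖τ.avg ψ s x‖ₑ ^ 2 :=
    ((τ.continuous_avg hψ).comp (f := fun s : ℝ => (s, x))
      (continuous_id.prodMk continuous_const)).enorm.measurable.pow_const 2
  rw [scaleMeasure, lintegral_withDensity_eq_lintegral_mul _ (by fun_prop) hV]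
  refine le_trans (le_of_eq ?_) (lintegral_Ioi_div_le_of_tsum_le hF h)
  refine setLIntegral_congr_fun measurableSet_Ioi fun t ht => ?_
  have ht0 : (0 : ℝ) < t := ht
  simp only [Pi.mul_apply, contLayer, enorm_smul, mul_pow]
  rw [← mul_assoc, mul_comm (‖τ.avg ψ t x‖ₑ ^ 2)]
  congr 1
  rw [Real.enorm_eq_ofReal (by positivity), ← ENNReal.ofReal_pow (by positivity),
    ← ENNReal.ofReal_mul (by positivity), ← Real.rpow_natCast (t ^ _), ← Real.rpow_mul ht0.le]
  congr 1
  rw [show (n : ℝ) / 2 * ((2 : ℕ) : ℝ) = n by push_cast; ring, Real.rpow_natCast]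
  field_simp
  ring

end Layers

theorem ae_scaleMeasurePi_pos (n m : ℕ) : ∀ᵐ t ∂scaleMeasurePi n m, ∀ i, 0 < t i := by
  have h : ∀ᵐ s ∂scaleMeasure n, (0 : ℝ) < s :=
    (withDensity_absolutelyContinuous _ _).ae_le (ae_restrict_mem measurableSet_Ioi)
  exact ae_all_iff.2 fun i => Measure.tendsto_eval_ae_ae.eventually h

/-- Lets the sum over ℤ^m be handled as an iterated integral, by the same induction as the
continuous case. -/
theorem pi_count_eq_count (m : ℕ) :
    Measure.pi (fun _ : Fin m => (Measure.count : Measure ℤ)) = Measure.count := by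
  refine Measure.ext_iff_singleton.2 fun a => ?_
  simp [Measure.pi_singleton]

end Scattering

/-! ### Assembly of the scattering estimates -/

open Scattering

theorem mainTheorem4 (n m : ℕ) (hn : 1 ≤ n) (hm : 1 ≤ m) (p q : ℝ) (hq1 : 1 < q) (hq2 : q < 2)
    (hpq : q * p = 2) (A ε ε' : ℝ) (hA : 0 < A) (hε : 0 < ε) (hε' : 0 < ε') :
    ∃ C : ℝ, 0 < C ∧
      ∀ ψ : EuclideanSpace ℝ (Fin n) → ℂ, Scattering.IsWavelet ψ →
        Scattering.DecayCondition A ε ψ → Scattering.HolderCondition A ε' ψ →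
      ∀ f : EuclideanSpace ℝ (Fin n) → ℂ, MemLp f (ENNReal.ofReal q) volume →
        ((∀ t : Fin m → ℝ, (∀ i, 0 < t i) →
            MemLp (Scattering.contCascade ψ f t) (ENNReal.ofReal q) volume) ∧
          MemLp (Scattering.contScattering (m := m) q ψ f) (ENNReal.ofReal p)
            (Scattering.scaleMeasurePi n m) ∧
          lpNorm (Scattering.contScattering (m := m) q ψ f) (ENNReal.ofReal p)
              (Scattering.scaleMeasurePi n m)
            ≤ C * lpNorm f (ENNReal.ofReal q) volume ^ q) ∧
        ((∀ j : Fin m → ℤ,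
            MemLp (Scattering.dyadCascade ψ f j) (ENNReal.ofReal q) volume) ∧
          Summable (fun j : Fin m → ℤ => |Scattering.dyadScattering q ψ f j| ^ p) ∧
          (∑' j : Fin m → ℤ, |Scattering.dyadScattering q ψ f j| ^ p) ^ (1 / p)
            ≤ C * lpNorm f (ENNReal.ofReal q) volume ^ q) := by
  have hq0 : 0 < q := by linarith
  have hp0 : 0 < p := by
    by_contra hp
    nlinarith
  have hfact1 : Fact (1 ≤ ENNReal.ofReal q) := ⟨ENNReal.one_le_ofReal.2 hq1.le⟩
  have hfact2 : Fact (ENNReal.ofReal q ≠ ∞) := ⟨ENNReal.ofReal_ne_top⟩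
  obtain ⟨C, hC, hbound⟩ := exists_sum_range_norm_avg_sq_le hn hA hε hε'
    (by linarith : 0 < (q - 1) / 16)
    (Lp ℂ (ENNReal.ofReal q) (volume : Measure (EuclideanSpace ℝ (Fin n))))
    (twoUniformlyConvex_Lp hq1 hq2)
  -- One factor `C` per layer for the squared norms; the root 1/p comes from the L^p norm over
  -- scales.
  refine ⟨(C ^ m) ^ (1 / p), by positivity, fun ψ hψ hdec hhol f hf => ?_⟩
  obtain ⟨m, rfl⟩ : ∃ k, m = k + 1 := ⟨m - 1, by omega⟩
  have hψi : Integrable ψ := memLp_one_iff_integrable.1 hψ.memLp_one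
  set τ : IsometricRep (EuclideanSpace ℝ (Fin n))
    (Lp ℂ (ENNReal.ofReal q) (volume : Measure (EuclideanSpace ℝ (Fin n)))) :=
    translationRep (ENNReal.ofReal q)
  set x := hf.toLp f with hx
  have hxn : lpNorm f (ENNReal.ofReal q) volume = ‖x‖ := by
    rw [hx, Lp.norm_toLp, toReal_eLpNorm hf.aestronglyMeasurable]
  have hsq := tsum_int_enorm_avg_sq_le hC.le (hbound ψ hψ hdec hhol) τ
  have hlp : ∀ {h : Lp ℂ (ENNReal.ofReal q) (volume : Measure (EuclideanSpace ℝ (Fin n)))}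
      {u : EuclideanSpace ℝ (Fin n) → ℂ}, h =ᵐ[volume] u →
      MemLp u (ENNReal.ofReal q) volume ∧ lpNorm u (ENNReal.ofReal q) volume = ‖h‖ := by
    intro h u hu
    have hmem := (memLp_congr_ae hu).1 (Lp.memLp h)
    refine ⟨hmem, ?_⟩
    rw [Lp.norm_def, eLpNorm_congr_ae hu, toReal_eLpNorm hmem.aestronglyMeasurable]
  have hcont : ∀ t : Fin (m + 1) → ℝ, (∀ i, 0 < t i) →
      (opCascade (contLayer τ ψ) modulus (m + 1) t x : Lp ℂ (ENNReal.ofReal q) volume) =ᵐ[volume] contCascade ψ f t :=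
    cascade_ae_eq (P := fun s : ℝ => 0 < s) (V := contLayer τ ψ) (g := dilate ψ) (fun s hs h => by
      rw [← avg_dilate τ ψ hs]
      exact avg_ae_eq_convolution _ (integrable_dilate hψi hs) h) hf (m + 1)
  have hdyad : ∀ j : Fin (m + 1) → ℤ,
      (opCascade (dyadLayer τ ψ) modulus (m + 1) j x : Lp ℂ (ENNReal.ofReal q) volume) =ᵐ[volume] dyadCascade ψ f j := fun j =>
    cascade_ae_eq (P := fun _ : ℤ => True) (V := dyadLayer τ ψ) (g := dyadicDilate ψ) (fun s _ h => by
      rw [← avg_dyadicDilate τ ψ s]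
      exact avg_ae_eq_convolution _ (integrable_dyadicDilate hψi s) h) hf (m + 1) j
      (fun _ => trivial)
  have hpowC : ENNReal.ofReal C ^ (m + 1) = ENNReal.ofReal (C ^ (m + 1)) :=
    (ENNReal.ofReal_pow hC.le _).symm
  rw [hxn]
  refine ⟨⟨fun t ht => (hlp (hcont t ht)).1, ?_⟩, fun j => (hlp (hdyad j)).1, ?_⟩
  · have hint := lintegral_opCascade_le (ν := scaleMeasure n) (continuous_contLayer τ hψi)
      continuous_modulus norm_modulus (B := ENNReal.ofReal C)
      (fun y => lintegral_contLayer_le τ hψi fun s => hsq s y) m x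
    rw [hpowC] at hint
    refine memLp_and_lpNorm_le_of_ae_eq
      (Z := fun t => opCascade (contLayer τ ψ) modulus (m + 1) t x)
      (continuous_opCascade (continuous_contLayer τ hψi) continuous_modulus
        (m + 1) x).norm.aestronglyMeasurable hq0 hp0 hpq ?_ (by positivity) x hint
    filter_upwards [ae_scaleMeasurePi_pos n (m + 1)] with t ht
    rw [contScattering, (hlp (hcont t ht)).2]
  · have hint := lintegral_opCascade_le (ν := (Measure.count : Measure ℤ))
      (continuous_dyadLayer τ hψi) continuous_modulus norm_modulus (B := ENNReal.ofReal C)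
      (fun y => by
        rw [lintegral_count]
        have h1 := hsq 1 y
        simp only [one_mul] at h1
        exact h1) m x
    rw [hpowC, pi_count_eq_count] at hint
    exact summable_and_tsum_le_of_lintegral_count_le
      (Z := fun j => opCascade (dyadLayer τ ψ) modulus (m + 1) j x) hp0 hpq
      (fun j => by rw [dyadScattering, (hlp (hdyad j)).2]) (by positivity) x hint
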